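/- **Setting.** Let $\ell\ge 1$. For $i=1,\dots,\ell$ let $G_i=\mathrm{SL}(2,\mathbb C)_i\,T_i$ be a complex algebraic group obtained from $\mathrm{SL}(2,\mathbb C)$ by enlarging its diagonal torus to a torus $T_i$ through a central extension, so that $\mathrm{SL}(2,\mathbb C)_i\cap T_i$ is the diagonal torus of $\mathrm{SL}(2,\mathbb C)_i$. Let $B_i=T_iN_i$ be the upper triangular subgroup, $N_i^-$ the lower unipotent subgroup, $U_i$ the compact form of $G_i$, $E_i$ the upper root vector, and $s_i=\begin{pmatrix}0&-1\\1&0\end{pmatrix}\in \mathrm{SL}(2,\mathbb C)_i$. Let $\gamma_i:T_i\to T_{i-1}$ ($2\le i\le\ell$) be homomorphisms of algebraic tori, extended to $B_i\to T_i\to T_{i-1}\subset B_{i-1}$. Put $G_{\rm s}=\prod G_i$, $B_{\rm s}=\prod B_i$, $U_{\rm s}=\prod U_i$, and let $\mathcal X=G_{\rm s}/B_{\rm s}$ be the quotient by the right action $$(g_\ell,g_{\ell-1},\dots,g_1)\cdot b=(g_\ell b_\ell,\ \gamma_\ell(b_\ell)^{-1}g_{\ell-1}b_{\ell-1},\ \dots,\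 \gamma_2(b_2)^{-1}g_1b_1).$$ For $z\in\mathbb C^\ell$ let $\xi(z)\in\mathcal X$ be the class of $(e^{z_\ell E_\ell}s_\ell,\dots,e^{z_1E_1}s_1)$. The map $z\mapsto\xi(z)$ is injective, and its inverse defines the affine coordinates $(z_i)$ on its open dense image; the points with all $z_i\neq 0$ form the open dense torus orbit. Let $\lambda=(\lambda_i)$ be a weight of $\prod T_i$, and let $c^\lambda(g)=\prod_i c(s_ig_i)^{\lambda_i}$, where $c(g_i)$ is the component of $g_i$ in $T_i$ according to $G_i\doteq N_i^-T_iN_i$. Let $\mathcal L_\lambda$ be the holomorphic line bundle on $\mathcal X$ whose sections are the holomorphic functions $f$ on $G_{\rm s}$ with $f(g\cdot b)=f(g)\,b^{\tilde\lambda}$, where $b^{\tilde\lambda}$ is the character $\prod_i b_i^{\lambda_i}\cdot\prod_{i<\ell}\big(s_i\gamma_{i+1}(b_{i+1})s_i^{-1}\big)^{-\lambda_i}$ of $B_{\rm s}$ according to which $c^\lambda$ transforms. Its unitary metric is $|f(\xi)|=|f(u)|$ if $\xi$ is the class of $u\in U_{\rm s}$. Let $K_\lambda=-\log|c^\lambda|^2$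 and, in terms of $z_j=e^{\tau_j+\sqrt{-1}\phi_j}$, $J_i=\tfrac12\,\partial K_\lambda/\partial\tau_i$ on the open orbit. The moment map $\pi=(J_1,\dots,J_\ell):\mathcal X\to\mathbb R^\ell$ is the continuous extension of $(J_1,\dots,J_\ell)$ to $\mathcal X$. Assume that $\lambda$ satisfies the positivity condition: $\min_{\mathcal X}J_i\ge 0$ for $i=1,\dots,\ell$. (This holds in particular if the curvature form of $\mathcal L_\lambda$ is positive.) **Theorem.** For $\eta=(n_1,\dots,n_\ell)\in\mathbb Z^\ell$ let $f_\eta=z_1^{n_1}\cdots z_\ell^{n_\ell}\,c^\lambda$, a holomorphic section of $\mathcal L_\lambda$ over the open orbit, and let $\Pi$ be the set of those $\eta$ for which $f_\eta$ extends to a global holomorphic section of $\mathcal L_\lambda$ on $\mathcal X$. Then $$\Pi=\pi(\mathcal X)\cap\mathbb Z^\ell,$$ i.e. $f_\eta$ extends if and only if $\eta$ belongs to the image $\pi(\mathcal X)$ of the moment map. The extensions of the $f_\eta$, $\eta\in\Pi$, form a basis of $H^0(\mathcal X,\mathcal L_\lambda)$. -/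

import Mathlib

open Filter Topology

namespace P1Chain

noncomputable section

/-- The algebraic character `t ↦ ∏ₐ tₐ ^ wₐ` of the torus `(ℂˣ)ᵏ` with integral weight `w`. -/
def character {k : ℕ} (w : Fin k → ℤ) : (Fin k → ℂˣ) →* ℂˣ where
  toFun t := ∏ a, t a ^ w a
  map_one' := by simp
  map_mul' s t := by simp [mul_zpow, Finset.prod_mul_distrib]

/-- The homomorphism of algebraic tori `(ℂˣ)ᵏ → (ℂˣ)ʲ` given by an integral matrix. -/
def torusHom {j k : ℕ} (M : Matrix (Fin j) (Fin k) ℤ) : (Fin k → ℂˣ) →* (Fin j → ℂˣ) :=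
  MonoidHom.mk' (fun t a => character (M a) t) (fun s t => by funext a; simp)

/-- The complex algebraic group `G` obtained from `SL(2,ℂ)` by enlarging its maximal torus
to a torus `T` of dimension `n + 1` through a central extension, as a subgroup of
`GL(2,ℂ) × (ℂˣ)ⁿ`:  the pairs `(A, s)` with `det A = s ^ d`.

Its maximal torus `T` consists of the `(diag (x, s^d x⁻¹), s)`, and is identified with `(ℂˣ)ⁿ⁺¹`
through `t = (x, s)`; the subgroup `SL(2,ℂ)` consists of the pairs `(A, 1)`; it meets `T` in the
image of the coroot `x ↦ (x, 1)`, and `G = SL(2,ℂ) · T`. The root is `α(x, s) = x² s^(-d)`.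
Every triple is of this form up to isomorphism: the coroot `H` of `SL(2,ℂ) ⊆ G` is an injective
cocharacter of `T`, hence a member of a basis of cocharacters, so that `T = ℂˣ × (ℂˣ)ⁿ` with
`H(x) = (x, 1)`, `α = (2, -d)` for some `d`, and `A · (x, s) ↦ (A diag (x, s^d x⁻¹), s)` is the
isomorphism. -/
def tripleGroup {n : ℕ} (d : Fin n → ℤ) : Subgroup (GL (Fin 2) ℂ × (Fin n → ℂˣ)) :=
  MonoidHom.eqLocus (Matrix.GeneralLinearGroup.det.comp (MonoidHom.fst _ _))
    ((character d).comp (MonoidHom.snd _ _))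

variable {n : ℕ} {d : Fin n → ℤ}

/-- The `2 × 2` matrix `A` of `g = (A, s)`. -/
def mat (g : tripleGroup d) : Matrix (Fin 2) (Fin 2) ℂ := (g.1.1 : Matrix (Fin 2) (Fin 2) ℂ)

/-- The inclusion of an element of `SL(2,ℂ)`. -/
def ofSL (A : Matrix.SpecialLinearGroup (Fin 2) ℂ) : tripleGroup d :=
  ⟨((A : GL (Fin 2) ℂ), 1), by
    change Matrix.GeneralLinearGroup.det (A : GL (Fin 2) ℂ) = character d 1
    simp⟩

/-- The inclusion `T → G`,  `(x, s) ↦ (diag (x, s^d x⁻¹), s)`. -/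
def ofTorus (t : Fin (n + 1) → ℂˣ) : tripleGroup d :=
  ⟨(Matrix.GeneralLinearGroup.mkOfDetNeZero
      !![(t 0 : ℂ), 0; 0, ((character d (Fin.tail t) * (t 0)⁻¹ : ℂˣ) : ℂ)]
      (by simp [Matrix.det_fin_two_of]), Fin.tail t), by
    change Matrix.GeneralLinearGroup.det _ = character d (Fin.tail t)
    ext
    simp [Matrix.GeneralLinearGroup.mkOfDetNeZero, Matrix.det_fin_two_of]
    field_simp⟩

/-- The element `e^{zE}`, where `E` is the root vector of the root `α`. -/
def expE (z : ℂ) : tripleGroup d := ofSL ⟨!![1, z; 0, 1], by simp [Matrix.det_fin_two_of]⟩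

/-- The representative in `SL(2,ℂ)` of the reflection. -/
def refl : tripleGroup d := ofSL ⟨!![0, -1; 1, 0], by simp [Matrix.det_fin_two_of]⟩

/-- The Borel subgroup `B = T N`: the upper triangular elements. -/
def borel (d : Fin n → ℤ) : Subgroup (tripleGroup d) where
  carrier := {g | mat g 1 0 = 0}
  one_mem' := by simp [mat]
  mul_mem' := by
    intro a b ha hb
    simp only [mat, Set.mem_ofPred_eq] at *
    simp [Matrix.mul_apply, Fin.sum_univ_two, ha, hb]
  inv_mem' := by
    intro a ha
    simp only [mat, Set.mem_ofPred_eq] at *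
    simp [Matrix.inv_def, Matrix.adjugate_fin_two, ha]

open Classical in
/-- The component `c(g)` in `T` according to the decomposition `G ≐ N⁻ T N`, which holds where
the upper left matrix entry does not vanish; on `B = T N` it is the projection to `T`. -/
def torusPart (g : tripleGroup d) : Fin (n + 1) → ℂˣ :=
  Fin.cons (if h : mat g 0 0 ≠ 0 then Units.mk0 (mat g 0 0) h else 1) g.1.2

/-- The compact real form `U` of `G`. -/
def IsCompactForm (u : tripleGroup d) : Prop :=
  mat u ∈ Matrix.unitaryGroup (Fin 2) ℂ ∧ ∀ a, ‖((u.1.2 a : ℂˣ) : ℂ)‖ = 1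

theorem torusPart_mul {a b : tripleGroup d} (ha : a ∈ borel d) (hb : b ∈ borel d) :
    torusPart (a * b) = torusPart a * torusPart b := by
  have ne : ∀ {a : tripleGroup d}, a ∈ borel d → mat a 0 0 ≠ 0 := by
    intro a ha h0
    have h1 : (mat a).det ≠ 0 := by
      simpa [mat] using (Matrix.GeneralLinearGroup.det a.1.1).ne_zero
    have h2 : mat a 1 0 = 0 := ha
    exact h1 (by simp [Matrix.det_fin_two, h0, h2])
  have hab : mat (a * b) 0 0 = mat a 0 0 * mat b 0 0 := by
    have h2 : mat b 1 0 = 0 := hb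
    have : mat (a * b) = mat a * mat b := by simp [mat]
    rw [this, Matrix.mul_apply, Fin.sum_univ_two, h2]
    ring
  funext i
  refine Fin.cases ?_ (fun j => ?_) i
  · ext
    simp [torusPart, ne ha, ne hb, hab]
  · simp [torusPart]

theorem torusPart_one : torusPart (1 : tripleGroup d) = 1 := by
  funext i
  refine Fin.cases ?_ (fun j => ?_) i
  · ext
    simp [torusPart, mat]
  · simp [torusPart]

theorem ofTorus_mul (s t : Fin (n + 1) → ℂˣ) :
    (ofTorus (s * t) : tripleGroup d) = ofTorus s * ofTorus t := by
  have ht : Fin.tail (s * t) = Fin.tail s * Fin.tail t := rfl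
  refine Subtype.ext (Prod.ext (Units.ext ?_) rfl)
  ext i j
  fin_cases i <;> fin_cases j <;>
    simp [ofTorus, Matrix.GeneralLinearGroup.mkOfDetNeZero, Matrix.mul_apply, Fin.sum_univ_two,
      ht]
  ring

theorem ofTorus_one : (ofTorus 1 : tripleGroup d) = 1 :=
  mul_eq_left.mp ((ofTorus_mul (d := d) 1 1).symm.trans (by rw [one_mul]))

/-- The data of a `ℙ¹`-chain of length `ℓ = m + 1`. The index `i : Fin (m + 1)` stands for the
`(i + 1)`-st triple `(Gᵢ, Bᵢ, Tᵢ)`; `Gᵢ` has torus `Tᵢ = (ℂˣ) ^ (rk i + 1)` and is given by the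
weight `det i`; the connecting homomorphism `T_{k+1} → T_k` is given by the integral matrix
`conn k`. -/
structure Data (m : ℕ) where
  rk : Fin (m + 1) → ℕ
  det : ∀ i, Fin (rk i) → ℤ
  conn : ∀ k : Fin m, Matrix (Fin (rk k.castSucc + 1)) (Fin (rk k.succ + 1)) ℤ

namespace Data

variable {m : ℕ} (D : Data m)

/-- The direct product `G_s = ∏ Gᵢ`. -/
abbrev Gs : Type := ∀ i, tripleGroup (D.det i)

/-- The direct product `B_s = ∏ Bᵢ`. -/
def Bs : Subgroup D.Gs := Subgroup.pi Set.univ (fun i => borel (D.det i))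

/-- The compact form `U_s = ∏ Uᵢ`. -/
def Us : Set D.Gs := {u | ∀ i, IsCompactForm (u i)}

/-- The element of `Tᵢ` obtained from `b_{i+1}` through `B_{i+1} → T_{i+1} → Tᵢ`; for the last
index `i = ℓ` it is `1`. -/
def incoming (b : D.Gs) (i : Fin (m + 1)) : Fin (D.rk i + 1) → ℂˣ :=
  Fin.lastCases (motive := fun i => Fin (D.rk i + 1) → ℂˣ) 1
    (fun k => torusHom (D.conn k) (torusPart (b k.succ))) i

/-- The right action of `B_s` on `G_s`:
`(g_ℓ, g_{ℓ-1}, …, g₁) · b = (g_ℓ b_ℓ, (b_ℓ γ)⁻¹ g_{ℓ-1} b_{ℓ-1}, …, (b₂ γ)⁻¹ g₁ b₁)`. -/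
def act (g b : D.Gs) : D.Gs := fun i => (ofTorus (D.incoming b i))⁻¹ * g i * b i

theorem incoming_one (i : Fin (m + 1)) : D.incoming 1 i = 1 := by
  refine Fin.lastCases ?_ (fun k => ?_) i
  · simp [incoming]
  · simp [incoming, torusPart_one]

theorem incoming_mul {b c : D.Gs} (hb : b ∈ D.Bs) (hc : c ∈ D.Bs) (i : Fin (m + 1)) :
    D.incoming (b * c) i = D.incoming b i * D.incoming c i := by
  refine Fin.lastCases ?_ (fun k => ?_) i
  · simp [incoming]
  · have h1 : b k.succ ∈ borel (D.det k.succ) := hb _ (Set.mem_univ _)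
    have h2 : c k.succ ∈ borel (D.det k.succ) := hc _ (Set.mem_univ _)
    simp [incoming, torusPart_mul h1 h2]

theorem act_one (g : D.Gs) : D.act g 1 = g := by
  funext i
  simp [act, incoming_one, ofTorus_one]

theorem act_act (g : D.Gs) {b c : D.Gs} (hb : b ∈ D.Bs) (hc : c ∈ D.Bs) :
    D.act (D.act g b) c = D.act g (b * c) := by
  funext i
  have h : D.incoming (b * c) i = D.incoming b i * D.incoming c i := D.incoming_mul hb hc i
  simp only [act, h, ofTorus_mul, mul_inv_rev, Pi.mul_apply]
  simp only [mul_assoc]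

/-- Equivalence modulo the right action of `B_s`. -/
def orbitSetoid : Setoid D.Gs where
  r g g' := ∃ b ∈ D.Bs, D.act g b = g'
  iseqv :=
    { refl := fun g => ⟨1, one_mem _, D.act_one g⟩
      symm := by
        rintro g _ ⟨b, hb, rfl⟩
        exact ⟨b⁻¹, inv_mem hb, by rw [D.act_act g hb (inv_mem hb), mul_inv_cancel, act_one]⟩
      trans := by
        rintro g _ _ ⟨b, hb, rfl⟩ ⟨c, hc, rfl⟩
        exact ⟨b * c, mul_mem hb hc, (D.act_act g hb hc).symm⟩ }

/-- The `ℙ¹`-chain `X = G_s / B_s`, with the quotient topology. -/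
abbrev X : Type := Quotient D.orbitSetoid

/-- The quotient map `G_s → X`. -/
def proj (g : D.Gs) : D.X := Quotient.mk D.orbitSetoid g

/-- The inverse of the affine coordinates: `z ↦ e^{z_ℓ E} s_ℓ . ⋯ . e^{z₁ E} s₁ . ξ₀`. -/
def chart (z : Fin (m + 1) → ℂ) : D.X := D.proj (fun i => expE (z i) * refl)

/-- The affine coordinates `(zᵢ)`, on the coordinate domain `Set.range D.chart`. -/
def coord : D.X → (Fin (m + 1) → ℂ) := Function.invFun D.chart

/-- The points of the coordinate domain all of whose coordinates are nonzero: the open dense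
orbit of the torus. -/
def openOrbit : Set D.X := D.chart '' {z | ∀ i, z i ≠ 0}

/-- The weights `λ = (λᵢ)` of the product torus `T_s = ∏ Tᵢ`. -/
abbrev Weight : Type := ∀ i, Fin (D.rk i + 1) → ℤ

variable (lam : D.Weight)

/-- The function `c^λ(g) = ∏ᵢ c(sᵢ gᵢ)^{λᵢ}` on `∏ Bᵢ sᵢ Bᵢ`. -/
def cSection (g : D.Gs) : ℂ :=
  ∏ i, ((character (lam i) (torusPart (refl * g i)) : ℂˣ) : ℂ)

/-- The character `b ↦ b ^ λ̃` of `B_s`, where `λ̃ᵢ = λᵢ - γ^*(s λ_{i-1})` with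
`(s μ)(t) = μ(s t s⁻¹)` and `γ^*` the pull-back by the connecting homomorphism `Tᵢ → T_{i-1}`;
thus `b ^ λ̃ = ∏ᵢ bᵢ^{λᵢ} (b_{i+1} γ)^{- s λᵢ}`. -/
def tildeCharacter (b : D.Gs) : ℂ :=
  ∏ i, ((character (lam i) (torusPart (b i)) *
    (character (lam i) (torusPart (refl * ofTorus (D.incoming b i) * refl⁻¹ :
      tripleGroup (D.det i))))⁻¹ : ℂˣ) : ℂ)

/-- The ambient vector space of the closed complex submanifold `G_s` of
`∏ᵢ (GL(2,ℂ) × (ℂˣ) ^ rk i)`. -/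
abbrev Ambient : Type := ∀ i, (Fin 2 → Fin 2 → ℂ) × (Fin (D.rk i) → ℂ)

/-- The inclusion of `G_s` into the ambient space. -/
def toAmbient (g : D.Gs) : D.Ambient :=
  fun i => (fun a b => mat (g i) a b, fun a => (((g i).1.2 a : ℂˣ) : ℂ))

/-- Holomorphic functions on `G_s`: those which are locally the restriction of a holomorphic
function of the ambient space. -/
def IsHolomorphic (f : D.Gs → ℂ) : Prop :=
  ∀ g, ∃ F : D.Ambient → ℂ, AnalyticAt ℂ F (D.toAmbient g) ∧
    ∀ᶠ h in 𝓝 g, f h = F (D.toAmbient h)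

/-- The space `H⁰(X, L_λ)` of global holomorphic sections of the line bundle
`L_λ = G_s ×_{B_s} ℂ_λ̃`: holomorphic functions on `G_s` with `f (g · b) = f (g) b ^ λ̃`. -/
def sections : Submodule ℂ (D.Gs → ℂ) where
  carrier := {f | D.IsHolomorphic f ∧
    ∀ g, ∀ b ∈ D.Bs, f (D.act g b) = f g * D.tildeCharacter lam b}
  zero_mem' := ⟨fun g => ⟨fun _ => 0, analyticAt_const, Eventually.of_forall fun _ => rfl⟩,
    fun g b _ => by simp⟩
  add_mem' := by
    rintro f f' ⟨hf, ef⟩ ⟨hf', ef'⟩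
    refine ⟨fun g => ?_, fun g b hb => ?_⟩
    · obtain ⟨F, hF, eF⟩ := hf g
      obtain ⟨F', hF', eF'⟩ := hf' g
      refine ⟨fun x => F x + F' x, hF.add hF', ?_⟩
      filter_upwards [eF, eF'] with h h1 h2
      simp [h1, h2]
    · simp [ef g b hb, ef' g b hb, add_mul]
  smul_mem' := by
    rintro c f ⟨hf, ef⟩
    refine ⟨fun g => ?_, fun g b hb => ?_⟩
    · obtain ⟨F, hF, eF⟩ := hf g
      refine ⟨fun x => c * F x, analyticAt_const.mul hF, ?_⟩
      filter_upwards [eF] with h h1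
      simp [h1]
    · simp [ef g b hb, mul_assoc]

open Classical in
/-- The pointwise norm of a section with respect to the unitary metric of `L_λ`:
`|f(ξ)| = |f(u)|` if `ξ = u . ξ₀` with `u ∈ U_s`. -/
def fiberNorm (f : D.Gs → ℂ) (ξ : D.X) : ℝ :=
  if h : ∃ u ∈ D.Us, D.proj u = ξ then ‖f h.choose‖ else 0

/-- The Kähler potential `K_λ = - log |c^λ|²`, a function on the coordinate domain. -/
def potential (ξ : D.X) : ℝ := -Real.log (D.fiberNorm (D.cSection lam) ξ ^ 2)

/-- The action variable `Jᵢ = ½ ∂K_λ / ∂τᵢ` at the point with coordinates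
`zⱼ = exp (τⱼ + √-1 φⱼ)`. -/
def actionVariable (z : Fin (m + 1) → ℂ) (i : Fin (m + 1)) : ℝ :=
  (1 / 2) * deriv
    (fun t : ℝ => D.potential lam (D.chart (Function.update z i ((Real.exp t : ℂ) * z i)))) 0

/-- The moment map `π = (J₁, …, J_ℓ)` on all of `X`, in the basis `ϖ₁, …, ϖ_ℓ` of the weight
lattice: the continuous extension of the action variables from the open dense orbit. -/
def momentMap : D.X → (Fin (m + 1) → ℝ) :=
  extendFrom D.openOrbit (fun ξ => D.actionVariable lam (D.coord ξ))

/-- The positivity condition on `λ`: `min Jᵢ ≥ 0` for all `i`, the minimum being over `X`. -/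
def PositivityCondition : Prop := ∀ ξ i, 0 ≤ D.momentMap lam ξ i

/-- The section `f_η = z^η c^λ`, on the part of `G_s` above the open orbit. -/
def monomialSection (η : Fin (m + 1) → ℤ) (g : D.Gs) : ℂ :=
  (∏ i, D.coord (D.proj g) i ^ η i) * D.cSection lam g

/-- `F` is an extension of `f_η` from the open orbit. -/
def IsExtension (η : Fin (m + 1) → ℤ) (F : D.Gs → ℂ) : Prop :=
  ∀ g, D.proj g ∈ D.openOrbit → F g = D.monomialSection lam η g

/-- The weight set `Π`: the integral weights `η = ∑ nᵢ ϖᵢ` for which `f_η` extends to a global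
holomorphic section of `L_λ`. -/
def weightSet : Set (Fin (m + 1) → ℤ) :=
  {η | ∃ F ∈ D.sections lam, D.IsExtension lam η F}

end Data

end

end P1Chain

/-!
The first column `(aᵢ, cᵢ)` and the central part `sᵢ` of `gᵢ` determine `g ∈ G_s` up to unipotent
elements, so that `B_s` acts effectively through its torus. A change of variables in the product
torus (`Data.twist`) decouples this action: a torus element `w` multiplies `cᵢ` and `sᵢ` by the
components of `wᵢ`, and `aᵢ` by `wᵢ` and the inverse of a character `rootWeight i` that involves the
`w_k` with `k > i` only (`Data.Related`). In these terms `f_η` is, up to a sign and a character of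
the central parts, the monomial `∏ aᵢ ^ ηᵢ cᵢ ^ (hᵢ(η) - ηᵢ)`, where `hᵢ(η)` is `⟨λᵢ, Hᵢ⟩` plus a
linear function of the `ηⱼ` with `j < i` (`Data.monomialSection_eq`).

If `0 ≤ ηᵢ ≤ hᵢ(η)` for all `i`, the monomial is a holomorphic function on `G_s`. Conversely, a
section is bounded on the compact group `∏ SU(2)`, whose first columns are arbitrary unit vectors,
and a monomial bounded there has nonnegative exponents. Hence the weight set consists of the
integral points of the twisted cube `0 ≤ xᵢ ≤ hᵢ(x)` (`Data.mem_weightSet_iff`).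

For the moment map, let `pᵢ = |aᵢ|²` at a unitary representative; this is a continuous function on
`X` with values in `[0, 1]`, and the `pᵢ` take all values independently. Differentiating the
potential `- ∑ ⟨λᵢ, Hᵢ⟩ log (1 - pᵢ)` gives the recursion `Jᵢ = pᵢ hᵢ(J)` on the open orbit
(`Data.actionVariable_eq`), whose right side extends continuously to `X` (`Data.momentMap_proj`).
If all `Jᵢ` are nonnegative on `X`, then so are the `hᵢ(J)`, as one sees at `pᵢ = 1`, and the image
is the twisted cube (`Data.range_momentMap`). This is the only use of the positivity condition;
without it the image is in general not the twisted cube.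

For the basis, a section is bounded on `∏ SU(2)`, hence grows polynomially in the affine coordinates
and is a polynomial in them (`Data.exists_mvPolynomial`). Averaging over the compact torus bounds
each of its monomials in the unitary metric, so that only exponents in the weight set occur
(`Data.mem_weightSet_of_coeff_ne_zero`). The `f_η` are linearly independent as distinct characters
of the torus.
-/

namespace P1Chain

noncomputable section

variable {n : ℕ} {d : Fin n → ℤ}

/-! ### Torus elements and first columns -/

/-- The action of the reflection on the torus `T`: `(x, s) ↦ (s ^ d x⁻¹, s)`. -/
def weyl (d : Fin n → ℤ) : (Fin (n + 1) → ℂˣ) →* (Fin (n + 1) → ℂˣ) where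
  toFun t := Fin.cons (character d (Fin.tail t) * (t 0)⁻¹) (Fin.tail t)
  map_one' := by
    funext i
    refine Fin.cases ?_ (fun j => ?_) i
    · have : Fin.tail (1 : Fin (n + 1) → ℂˣ) = 1 := rfl
      simp [this]
    · simp [Fin.tail]
  map_mul' s t := by
    funext i
    have h : Fin.tail (s * t) = Fin.tail s * Fin.tail t := rfl
    refine Fin.cases ?_ (fun j => ?_) i
    · simp only [h, map_mul, Fin.cons_zero, Pi.mul_apply, mul_inv]
      exact mul_mul_mul_comm _ _ _ _
    · simp [Fin.tail]

theorem weyl_zero (t : Fin (n + 1) → ℂˣ) :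
    weyl d t 0 = character d (Fin.tail t) * (t 0)⁻¹ := rfl

theorem tail_weyl (t : Fin (n + 1) → ℂˣ) : Fin.tail (weyl d t) = Fin.tail t := by
  funext j; simp [weyl, Fin.tail]

theorem mat_mul (g h : tripleGroup d) : mat (g * h) = mat g * mat h := by simp [mat]

theorem mat_ofTorus (t : Fin (n + 1) → ℂˣ) :
    mat (ofTorus t : tripleGroup d) = !![(t 0 : ℂ), 0; 0, ((weyl d t 0 : ℂˣ) : ℂ)] := rfl

theorem snd_ofTorus (t : Fin (n + 1) → ℂˣ) :
    (ofTorus t : tripleGroup d).1.2 = Fin.tail t := rfl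

theorem mat_refl : mat (refl : tripleGroup d) = !![0, -1; 1, 0] := rfl

theorem mat_expE (z : ℂ) : mat (expE z : tripleGroup d) = !![1, z; 0, 1] := rfl

theorem ofTorus_inv (t : Fin (n + 1) → ℂˣ) :
    (ofTorus t : tripleGroup d)⁻¹ = ofTorus t⁻¹ := by
  rw [inv_eq_iff_mul_eq_one, ← ofTorus_mul, mul_inv_cancel, ofTorus_one]

theorem torusPart_ofTorus (t : Fin (n + 1) → ℂˣ) : torusPart (ofTorus t : tripleGroup d) = t := by
  funext i
  refine Fin.cases ?_ (fun j => ?_) i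
  · ext; simp [torusPart, mat_ofTorus]
  · simp [torusPart, snd_ofTorus, Fin.tail]

theorem torusPart_refl_conj (t : Fin (n + 1) → ℂˣ) :
    torusPart (refl * ofTorus t * refl⁻¹ : tripleGroup d) = weyl d t := by
  have h : (refl * ofTorus t * refl⁻¹ : tripleGroup d) = ofTorus (weyl d t) := by
    rw [mul_inv_eq_iff_eq_mul]
    refine Subtype.ext (Prod.ext (Units.ext ?_) ?_)
    · change mat (refl * ofTorus t : tripleGroup d) = mat (ofTorus (weyl d t) * refl)
      rw [mat_mul, mat_mul, mat_ofTorus, mat_ofTorus, mat_refl, weyl_zero (weyl d t), tail_weyl]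
      ext i j
      fin_cases i <;> fin_cases j <;> simp [Matrix.mul_apply, Fin.sum_univ_two, weyl_zero]
    · change (refl : tripleGroup d).1.2 * Fin.tail t = Fin.tail (weyl d t) * 1
      rw [tail_weyl, mul_one]
      exact one_mul _
  rw [h, torusPart_ofTorus]

theorem borel_apply_ne_zero {b : tripleGroup d} (hb : b ∈ borel d) : mat b 0 0 ≠ 0 := by
  intro h0
  have h1 : (mat b).det ≠ 0 := by
    simpa [mat] using (Matrix.GeneralLinearGroup.det b.1.1).ne_zero
  have h2 : mat b 1 0 = 0 := hb
  exact h1 (by simp [Matrix.det_fin_two, h0, h2])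

theorem torusPart_zero {b : tripleGroup d} (hb : mat b 0 0 ≠ 0) :
    ((torusPart b 0 : ℂˣ) : ℂ) = mat b 0 0 := by
  simp [torusPart, hb]

theorem tail_torusPart (b : tripleGroup d) : Fin.tail (torusPart b) = b.1.2 := by
  funext j; simp [torusPart, Fin.tail]

theorem ofTorus_mem_borel (t : Fin (n + 1) → ℂˣ) : (ofTorus t : tripleGroup d) ∈ borel d := by
  change mat (ofTorus t : tripleGroup d) 1 0 = 0
  simp [mat_ofTorus]

/-- Two elements with the same first column and the same central part differ by a unipotent
upper triangular factor. -/
theorem inv_mul_mem_borel {g h : tripleGroup d} (h0 : mat g 0 0 = mat h 0 0)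
    (h1 : mat g 1 0 = mat h 1 0) (hs : g.1.2 = h.1.2) :
    g⁻¹ * h ∈ borel d ∧ torusPart (g⁻¹ * h) = 1 := by
  have key : ∀ i, mat (g⁻¹ * h) i 0 = mat (g⁻¹ * g) i 0 := by
    intro i
    rw [mat_mul, mat_mul]
    simp [Matrix.mul_apply, Fin.sum_univ_two, h0, h1]
  have k0 : mat (g⁻¹ * h) 0 0 = 1 := by rw [key]; simp [mat]
  have k1 : mat (g⁻¹ * h) 1 0 = 0 := by rw [key]; simp [mat]
  refine ⟨k1, ?_⟩
  funext i
  refine Fin.cases ?_ (fun j => ?_) i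
  · ext; rw [torusPart_zero (by simp [k0]), k0]; rfl
  · have : (g⁻¹ * h).1.2 = 1 := by
      change g.1.2⁻¹ * h.1.2 = 1
      rw [hs, inv_mul_cancel]
    exact congrFun this j

theorem character_add (v w : Fin n → ℤ) (t : Fin n → ℂˣ) :
    character (v + w) t = character v t * character w t := by
  simp [character, zpow_add, Finset.prod_mul_distrib]

theorem character_zsmul (c : ℤ) (w : Fin n → ℤ) (t : Fin n → ℂˣ) :
    character (c • w) t = character w t ^ c := by
  simp [character, mul_comm c, zpow_mul, Finset.prod_zpow]

theorem character_zero (t : Fin n → ℂˣ) : character (0 : Fin n → ℤ) t = 1 := by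
  simp [character]

theorem character_succ (w : Fin (n + 1) → ℤ) (t : Fin (n + 1) → ℂˣ) :
    character w t = t 0 ^ w 0 * character (Fin.tail w) (Fin.tail t) := by
  simp [character, Fin.prod_univ_succ, Fin.tail]

namespace Data

variable {m : ℕ} (D : Data m)

/-! ### The twisting homomorphism of the product torus -/

/-- The product torus `T_s = ∏ Tᵢ`. -/
abbrev Ts : Type := ∀ i, Fin (D.rk i + 1) → ℂˣ

/-- The element of `Tᵢ` obtained from `t_{i+1}` through the connecting homomorphism. -/
def inc (t : D.Ts) (i : Fin (m + 1)) : Fin (D.rk i + 1) → ℂˣ :=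
  Fin.lastCases (motive := fun i => Fin (D.rk i + 1) → ℂˣ) 1
    (fun k => torusHom (D.conn k) (t k.succ)) i

theorem inc_last (t : D.Ts) : D.inc t (Fin.last m) = 1 := by simp [inc]

theorem inc_castSucc (t : D.Ts) (k : Fin m) :
    D.inc t k.castSucc = torusHom (D.conn k) (t k.succ) := by simp [inc]

theorem incoming_eq (b : D.Gs) (i : Fin (m + 1)) :
    D.incoming b i = D.inc (fun i => torusPart (b i)) i := rfl

/-- The endomorphism `t ↦ (tᵢ · s (t_{i+1} γ)⁻¹ s⁻¹)ᵢ` of the product torus: the factor by which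
the lower left matrix entries and the central parts of `g ∈ G_s` change under `t`. -/
def twist (t : D.Ts) : D.Ts := fun i => t i * (weyl (D.det i) (D.inc t i))⁻¹

theorem twist_surjective : Function.Surjective D.twist := by
  intro w
  let t : D.Ts := Fin.reverseInduction (motive := fun i => Fin (D.rk i + 1) → ℂˣ)
    (w (Fin.last m))
    (fun k tk => w k.castSucc * weyl (D.det k.castSucc) (torusHom (D.conn k) tk))
  refine ⟨t, funext fun i => ?_⟩
  refine Fin.lastCases ?_ (fun k => ?_) i
  · simp [twist, inc_last, t]
  · have h : t k.castSucc
        = w k.castSucc * weyl (D.det k.castSucc) (torusHom (D.conn k) (t k.succ)) := by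
      simp [t]
    rw [twist, inc_castSucc, h, mul_inv_cancel_right]

/-- The character of the product torus with weight `M`. -/
def weightChar (M : D.Weight) : D.Ts →* ℂˣ where
  toFun w := ∏ k, character (M k) (w k)
  map_one' := by simp
  map_mul' v w := by simp [Finset.prod_mul_distrib]

theorem weightChar_apply (M : D.Weight) (w : D.Ts) :
    D.weightChar M w = ∏ k, character (M k) (w k) := rfl

theorem weightChar_add (M N : D.Weight) (w : D.Ts) :
    D.weightChar (M + N) w = D.weightChar M w * D.weightChar N w := by
  simp [weightChar_apply, character_add, Finset.prod_mul_distrib]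

theorem weightChar_zsmul (c : ℤ) (M : D.Weight) (w : D.Ts) :
    D.weightChar (c • M) w = D.weightChar M w ^ c := by
  simp only [weightChar_apply, ← Finset.prod_zpow]
  exact Finset.prod_congr rfl fun k _ => character_zsmul c (M k) (w k)

theorem weightChar_zero (w : D.Ts) : D.weightChar 0 w = 1 := by
  simp [weightChar_apply, character_zero]

theorem weightChar_sum {ι : Type*} (s : Finset ι) (M : ι → D.Weight) (w : D.Ts) :
    D.weightChar (∑ a ∈ s, M a) w = ∏ a ∈ s, D.weightChar (M a) w := by
  classical
  induction s using Finset.induction_on with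
  | empty => simp [weightChar_zero]
  | insert a s ha ih => rw [Finset.sum_insert ha, Finset.prod_insert ha, weightChar_add, ih]

theorem exists_inc_weight (i : Fin (m + 1)) (H : ∀ k : Fin m, k.castSucc = i →
      ∀ a, ∃ M : D.Weight, (∀ l < k.succ, M l = 0) ∧
        ∀ t, t k.succ a = D.weightChar M (D.twist t)) (a : Fin (D.rk i + 1)) :
    ∃ M : D.Weight, (∀ l ≤ i, M l = 0) ∧ ∀ t, D.inc t i a = D.weightChar M (D.twist t) := by
  induction i using Fin.lastCases with
  | last => exact ⟨0, fun _ _ => rfl, fun t => by rw [inc_last, weightChar_zero]; rfl⟩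
  | cast k =>
    choose M hM hM' using H k rfl
    refine ⟨∑ b, D.conn k a b • M b, fun l hl => ?_, fun t => ?_⟩
    · have : ∀ b, M b l = 0 := fun b => hM b l (Fin.le_castSucc_iff.mp hl)
      simp [this]
    · rw [inc_castSucc, weightChar_sum]
      change ∏ b, t k.succ b ^ D.conn k a b = _
      exact Finset.prod_congr rfl fun b _ => by rw [weightChar_zsmul, ← hM']

theorem exists_weyl_weight (i : Fin (m + 1)) (H : ∀ a, ∃ M : D.Weight, (∀ l ≤ i, M l = 0) ∧
      ∀ t, D.inc t i a = D.weightChar M (D.twist t)) (a : Fin (D.rk i + 1)) :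
    ∃ M : D.Weight, (∀ l ≤ i, M l = 0) ∧
      ∀ t, weyl (D.det i) (D.inc t i) a = D.weightChar M (D.twist t) := by
  choose M hM hM' using H
  induction a using Fin.cases with
  | zero =>
    refine ⟨∑ b : Fin (D.rk i), D.det i b • M b.succ + (-1 : ℤ) • M 0, fun l hl => ?_,
      fun t => ?_⟩
    · have : ∀ b, M b l = 0 := fun b => hM b l hl
      simp [this]
    · rw [weightChar_add, weightChar_sum, weightChar_zsmul, ← hM', zpow_neg_one, weyl_zero]
      congr 1
      change ∏ b : Fin (D.rk i), D.inc t i b.succ ^ D.det i b = _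
      exact Finset.prod_congr rfl fun b _ => by rw [weightChar_zsmul, ← hM']
  | succ b => exact ⟨M b.succ, hM b.succ, fun t => by rw [← hM']; rfl⟩

/-- The coordinates of `tᵢ` are characters of the factors `(twist t)_k` with `k ≥ i`. -/
theorem exists_coordinate_weight (i : Fin (m + 1)) (a : Fin (D.rk i + 1)) :
    ∃ M : D.Weight, (∀ l < i, M l = 0) ∧ ∀ t, t i a = D.weightChar M (D.twist t) := by
  have step : ∀ i : Fin (m + 1), (∀ k : Fin m, k.castSucc = i →
      ∀ a, ∃ M : D.Weight, (∀ l < k.succ, M l = 0) ∧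
        ∀ t, t k.succ a = D.weightChar M (D.twist t)) → ∀ a, ∃ M : D.Weight,
        (∀ l < i, M l = 0) ∧ ∀ t, t i a = D.weightChar M (D.twist t) := by
    intro i H a
    obtain ⟨M, hM, hM'⟩ := D.exists_weyl_weight i (D.exists_inc_weight i H) a
    refine ⟨M + Pi.single i (Pi.single a 1), fun l hl => ?_, fun t => ?_⟩
    · simp [hM l hl.le, Pi.single_eq_of_ne hl.ne]
    · have : D.weightChar (Pi.single i (Pi.single a 1)) (D.twist t) = D.twist t i a := by
        rw [weightChar_apply, Finset.prod_eq_single i]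
        · simp only [Pi.single_eq_same, character]
          change ∏ b, D.twist t i b ^ (Pi.single a (1 : ℤ) : Fin (D.rk i + 1) → ℤ) b = _
          rw [Finset.prod_eq_single a] <;> simp +contextual
        · intro k _ hk
          rw [Pi.single_eq_of_ne hk, character_zero]
        · simp
      rw [weightChar_add, ← hM', this]
      simp [twist]
  induction i using Fin.reverseInduction with
  | last => exact step _ (fun k hk => absurd hk (Fin.castSucc_lt_last k).ne) a
  | cast k ih =>
    refine step _ (fun k' hk' => ?_) a
    obtain rfl := Fin.castSucc_injective _ hk'
    exact ih

theorem exists_rootWeight (i : Fin (m + 1)) :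
    ∃ M : D.Weight, (∀ l ≤ i, M l = 0) ∧ ∀ t, D.inc t i 0 * (weyl (D.det i) (D.inc t i) 0)⁻¹
      = D.weightChar M (D.twist t) := by
  have h1 := D.exists_inc_weight i (fun k _ => D.exists_coordinate_weight k.succ)
  obtain ⟨M, hM, hM'⟩ := h1 0
  obtain ⟨N, hN, hN'⟩ := D.exists_weyl_weight i h1 0
  refine ⟨M + (-1 : ℤ) • N, fun l hl => by simp [hM l hl, hN l hl], fun t => ?_⟩
  rw [hM', hN', weightChar_add, weightChar_zsmul, zpow_neg_one]

/-- The weight through which the root of `Gᵢ` at the incoming torus element depends on the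
twisted torus element: `α(t_{i+1} γ) = (twist t) ^ (rootWeight i)`. -/
def rootWeight (i : Fin (m + 1)) : D.Weight := (D.exists_rootWeight i).choose

theorem rootWeight_eq_zero {i k : Fin (m + 1)} (h : k ≤ i) : D.rootWeight i k = 0 :=
  (D.exists_rootWeight i).choose_spec.1 k h

theorem weightChar_rootWeight_twist (i : Fin (m + 1)) (t : D.Ts) :
    D.weightChar (D.rootWeight i) (D.twist t)
      = D.inc t i 0 * (weyl (D.det i) (D.inc t i) 0)⁻¹ :=
  ((D.exists_rootWeight i).choose_spec.2 t).symm

/-! ### The orbits of the Borel subgroup in terms of first columns -/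

/-- `g'` arises from `g` by the twisted torus element `w`, as far as first columns and central
parts are concerned. These determine the `N`-orbits, so that the relation describes the `B_s`-orbits
(`related_act`, `Related.exists_act`). -/
def Related (g g' : D.Gs) (w : D.Ts) : Prop :=
  ∀ i, mat (g' i) 0 0
      = mat (g i) 0 0 * (w i 0 : ℂ) * ((D.weightChar (D.rootWeight i) w : ℂˣ) : ℂ)⁻¹ ∧
    mat (g' i) 1 0 = mat (g i) 1 0 * (w i 0 : ℂ) ∧ (g' i).1.2 = (g i).1.2 * Fin.tail (w i)

variable {D}

theorem related_act (g : D.Gs) {b : D.Gs} (hb : b ∈ D.Bs) :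
    D.Related g (D.act g b) (D.twist (fun i => torusPart (b i))) := by
  intro i
  have hbi : b i ∈ borel (D.det i) := hb i (Set.mem_univ _)
  have hb0 : mat (b i) 1 0 = 0 := hbi
  have hb1 := torusPart_zero (borel_apply_ne_zero hbi)
  have hcol : ∀ j, mat (D.act g b i) j 0
      = mat ((ofTorus (D.incoming b i))⁻¹ * g i) j 0 * mat (b i) 0 0 := by
    intro j
    change mat ((ofTorus (D.incoming b i))⁻¹ * g i * b i) j 0 = _
    rw [mat_mul, Matrix.mul_apply, Fin.sum_univ_two, hb0]
    ring
  rw [hcol, hcol, weightChar_rootWeight_twist, ofTorus_inv, mat_mul, mat_ofTorus, map_inv]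
  simp only [← hb1, incoming_eq]
  set t := D.inc (fun i => torusPart (b i)) i with ht
  refine ⟨?_, ?_, ?_⟩
  · simp [Matrix.mul_apply, Fin.sum_univ_two, twist, ← ht]
    field_simp
  · simp [Matrix.mul_apply, Fin.sum_univ_two, twist, ← ht]
    ring
  · change (ofTorus (D.incoming b i) : tripleGroup (D.det i)).1.2⁻¹ * (g i).1.2 * (b i).1.2 = _
    have : Fin.tail (D.twist (fun i => torusPart (b i)) i) = Fin.tail (torusPart (b i)) *
      (Fin.tail (weyl (D.det i) t))⁻¹ := rfl
    rw [this, tail_weyl, tail_torusPart, snd_ofTorus, incoming_eq, ← ht]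
    rw [mul_comm _ (g i).1.2, mul_assoc, mul_comm (Fin.tail t)⁻¹]

theorem tildeCharacter_eq (lam : D.Weight) (b : D.Gs) :
    D.tildeCharacter lam b
      = ((D.weightChar lam (D.twist (fun i => torusPart (b i))) : ℂˣ) : ℂ) := by
  rw [weightChar_apply, Units.coe_prod]
  refine Finset.prod_congr rfl fun i _ => ?_
  rw [torusPart_refl_conj, twist, map_mul, map_inv]
  rfl

theorem Related.exists_act {g g' : D.Gs} {w : D.Ts} (h : D.Related g g' w) (lam : D.Weight) :
    ∃ b ∈ D.Bs, D.act g b = g' ∧ D.tildeCharacter lam b = ((D.weightChar lam w : ℂˣ) : ℂ) := by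
  obtain ⟨t, rfl⟩ := D.twist_surjective w
  let b₀ : D.Gs := fun i => ofTorus (t i)
  have hb₀ : b₀ ∈ D.Bs := fun i _ => ofTorus_mem_borel _
  have ht : (fun i => torusPart (b₀ i)) = t := funext fun i => torusPart_ofTorus _
  have h₀ := related_act g hb₀
  rw [ht] at h₀
  let b₁ : D.Gs := fun i => (D.act g b₀ i)⁻¹ * g' i
  have key : ∀ i, b₁ i ∈ borel (D.det i) ∧ torusPart (b₁ i) = 1 := fun i =>
    inv_mul_mem_borel ((h₀ i).1.trans (h i).1.symm) ((h₀ i).2.1.trans (h i).2.1.symm)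
      ((h₀ i).2.2.trans (h i).2.2.symm)
  have hb₁ : b₁ ∈ D.Bs := fun i _ => (key i).1
  have hinc : ∀ i, D.incoming b₁ i = 1 := by
    intro i
    rw [incoming_eq, show (fun i => torusPart (b₁ i)) = fun i => torusPart ((1 : D.Gs) i) from
      funext fun i => (key i).2.trans torusPart_one.symm]
    exact D.incoming_one i
  refine ⟨b₀ * b₁, mul_mem hb₀ hb₁, ?_, ?_⟩
  · rw [← D.act_act g hb₀ hb₁]
    funext i
    change (ofTorus (D.incoming b₁ i))⁻¹ * D.act g b₀ i * ((D.act g b₀ i)⁻¹ * g' i) = g' i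
    rw [hinc, ofTorus_one, inv_one, one_mul, mul_inv_cancel_left]
  · rw [tildeCharacter_eq, show (fun i => torusPart ((b₀ * b₁) i)) = t from funext fun i => by
      rw [Pi.mul_apply, torusPart_mul (hb₀ i trivial) (hb₁ i trivial), (key i).2, mul_one,
        torusPart_ofTorus]]

theorem proj_eq_iff {g g' : D.Gs} : D.proj g = D.proj g' ↔ ∃ w, D.Related g g' w := by
  constructor
  · intro h
    obtain ⟨b, hb, rfl⟩ := Quotient.exact h
    exact ⟨_, related_act g hb⟩
  · rintro ⟨w, h⟩
    obtain ⟨b, hb, e, -⟩ := h.exists_act 0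
    exact Quotient.sound ⟨b, hb, e⟩

theorem Related.apply_section {g g' : D.Gs} {w : D.Ts} (h : D.Related g g' w) {lam : D.Weight}
    {f : D.Gs → ℂ} (hf : f ∈ D.sections lam) :
    f g' = f g * ((D.weightChar lam w : ℂˣ) : ℂ) := by
  obtain ⟨b, hb, rfl, e⟩ := h.exists_act lam
  rw [← e]
  exact hf.2 g b hb

end Data

/-! ### Topology of the groups -/

theorem continuous_mat : Continuous (mat : tripleGroup d → Matrix (Fin 2) (Fin 2) ℂ) :=
  Units.continuous_val.comp (continuous_fst.comp continuous_subtype_val)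

theorem continuous_mat_apply (i j : Fin 2) : Continuous fun g : tripleGroup d => mat g i j :=
  continuous_mat.matrix_elem i j

theorem continuous_central (a : Fin n) : Continuous fun g : tripleGroup d => g.1.2 a :=
  (continuous_apply a).comp (continuous_snd.comp continuous_subtype_val)

theorem continuous_of_mat {Y : Type*} [TopologicalSpace Y] {f : Y → tripleGroup d}
    (h : ∀ i j, Continuous fun y => mat (f y) i j) (hs : Continuous fun y => (f y).1.2) :
    Continuous f := by
  have h' : Continuous fun y => mat (f y) := continuous_matrix h
  refine Continuous.subtype_mk (Continuous.prodMk (Units.continuous_iff.mpr ⟨h', ?_⟩) hs) _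
  have e : ∀ y, (((f y).1.1⁻¹ : GL (Fin 2) ℂ) : Matrix (Fin 2) (Fin 2) ℂ)
      = (mat (f y)).det⁻¹ • (mat (f y)).adjugate := by
    intro y
    rw [Matrix.coe_units_inv, Matrix.inv_def, Ring.inverse_eq_inv']
    rfl
  change Continuous fun y => (((f y).1.1⁻¹ : GL (Fin 2) ℂ) : Matrix (Fin 2) (Fin 2) ℂ)
  simp only [e]
  refine Continuous.smul (h'.matrix_det.inv₀ fun y => ?_) h'.matrix_adjugate
  simpa [mat] using (Matrix.GeneralLinearGroup.det (f y).1.1).ne_zero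

theorem column_ne_zero (g : tripleGroup d) : mat g 0 0 ≠ 0 ∨ mat g 1 0 ≠ 0 := by
  by_contra! h
  have h1 : (mat g).det ≠ 0 := by
    simpa [mat] using (Matrix.GeneralLinearGroup.det g.1.1).ne_zero
  exact h1 (by simp [Matrix.det_fin_two, h.1, h.2])

/-- The elements of `SL(2,ℂ) ⊆ G` with matrix `(1 + ε², ε; ε, 1)`. -/
def shear (ε : ℂ) : tripleGroup d :=
  ofSL ⟨!![1 + ε ^ 2, ε; ε, 1], by simp [Matrix.det_fin_two_of]; ring⟩

theorem mat_shear (ε : ℂ) : mat (shear ε : tripleGroup d) = !![1 + ε ^ 2, ε; ε, 1] := rfl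

theorem continuous_shear : Continuous (shear : ℂ → tripleGroup d) := by
  refine continuous_of_mat (fun i j => ?_) continuous_const
  fin_cases i <;> fin_cases j <;> simp only [mat_shear] <;> simp <;> fun_prop

theorem dense_column_ne_zero :
    Dense {g : tripleGroup d | mat g 0 0 ≠ 0 ∧ mat g 1 0 ≠ 0} := by
  intro g
  have hc : Continuous fun ε : ℂ => (shear ε * g : tripleGroup d) :=
    continuous_shear.mul continuous_const
  have h1 : Tendsto (fun ε : ℂ => (shear ε * g : tripleGroup d)) (𝓝[≠] 0) (𝓝 g) := by
    have : (shear 0 * g : tripleGroup d) = g := by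
      have h : (shear 0 : tripleGroup d) = 1 := by
        refine Subtype.ext (Prod.ext (Units.ext ?_) rfl)
        change mat (shear 0 : tripleGroup d) = 1
        rw [mat_shear, Matrix.one_fin_two]
        simp
      rw [h, one_mul]
    have h0 := hc.tendsto 0
    rw [this] at h0
    exact h0.mono_left nhdsWithin_le_nhds
  refine mem_closure_of_tendsto h1 ?_
  have e0 : ∀ ε : ℂ, mat (shear ε * g) 0 0 = (1 + ε ^ 2) * mat g 0 0 + ε * mat g 1 0 := by
    intro ε; rw [mat_mul, mat_shear]; simp [Matrix.mul_apply, Fin.sum_univ_two]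
  have e1 : ∀ ε : ℂ, mat (shear ε * g) 1 0 = ε * mat g 0 0 + mat g 1 0 := by
    intro ε; rw [mat_mul, mat_shear]; simp [Matrix.mul_apply, Fin.sum_univ_two]
  have c0 : Continuous fun ε : ℂ => (1 + ε ^ 2) * mat g 0 0 + ε * mat g 1 0 := by fun_prop
  have c1 : Continuous fun ε : ℂ => ε * mat g 0 0 + mat g 1 0 := by fun_prop
  have hne : ∀ᶠ ε : ℂ in 𝓝[≠] 0, ε ≠ 0 := self_mem_nhdsWithin
  simp only [Set.mem_ofPred_eq, e0, e1]
  refine Eventually.and ?_ ?_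
  · by_cases ha : mat g 0 0 = 0
    · have hc := (column_ne_zero g).resolve_left (not_not.mpr ha)
      filter_upwards [hne] with ε hε
      simp [ha, hε, hc]
    · refine (c0.continuousAt.eventually_ne (y := 0) ?_).filter_mono nhdsWithin_le_nhds
      simpa using ha
  · by_cases hb : mat g 1 0 = 0
    · have hc := (column_ne_zero g).resolve_right (not_not.mpr hb)
      filter_upwards [hne] with ε hε
      simp [hb, hε, hc]
    · refine (c1.continuousAt.eventually_ne (y := 0) ?_).filter_mono nhdsWithin_le_nhds
      simpa using hb

/-- The unit sphere of `ℂ²`, as the set of first columns of `SU(2)`. -/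
abbrev UnitColumn : Type := {v : ℂ × ℂ // ‖v.1‖ ^ 2 + ‖v.2‖ ^ 2 = 1}

instance : CompactSpace UnitColumn := by
  refine isCompact_iff_compactSpace.mp (Metric.isCompact_of_isClosed_isBounded
    (isClosed_eq (by fun_prop) continuous_const) ?_)
  refine (Metric.isBounded_closedBall (x := (0 : ℂ × ℂ)) (r := 1)).subset fun v hv => ?_
  have hv : ‖v.1‖ ^ 2 + ‖v.2‖ ^ 2 = 1 := hv
  rw [mem_closedBall_zero_iff, Prod.norm_def, sup_le_iff]
  constructor <;> nlinarith [norm_nonneg v.1, norm_nonneg v.2]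

/-- The element of `SU(2)` with given first column. -/
def ofUnitColumn (v : UnitColumn) : tripleGroup d :=
  ofSL ⟨!![v.1.1, -(starRingEnd ℂ) v.1.2; v.1.2, (starRingEnd ℂ) v.1.1], by
    have h := v.2
    rw [Matrix.det_fin_two_of, neg_mul, sub_neg_eq_add, Complex.mul_conj, mul_comm,
      Complex.mul_conj, Complex.normSq_eq_norm_sq, Complex.normSq_eq_norm_sq]
    exact_mod_cast h⟩

theorem mat_ofUnitColumn (v : UnitColumn) : mat (ofUnitColumn v : tripleGroup d)
    = !![v.1.1, -(starRingEnd ℂ) v.1.2; v.1.2, (starRingEnd ℂ) v.1.1] := rfl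

theorem continuous_ofUnitColumn : Continuous (ofUnitColumn : UnitColumn → tripleGroup d) := by
  refine continuous_of_mat (fun i j => ?_) continuous_const
  fin_cases i <;> fin_cases j <;> simp only [mat_ofUnitColumn] <;> simp <;> fun_prop

theorem isCompactForm_ofUnitColumn (v : UnitColumn) :
    IsCompactForm (ofUnitColumn v : tripleGroup d) := by
  have h : v.1.1 * (starRingEnd ℂ) v.1.1 + v.1.2 * (starRingEnd ℂ) v.1.2 = 1 := by
    have h := v.2
    rw [Complex.mul_conj, Complex.mul_conj, Complex.normSq_eq_norm_sq, Complex.normSq_eq_norm_sq]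
    exact_mod_cast h
  refine ⟨?_, fun a => by simp [ofUnitColumn, ofSL]⟩
  rw [Matrix.mem_unitaryGroup_iff, mat_ofUnitColumn]
  ext i j
  fin_cases i <;> fin_cases j <;>
    simp [Matrix.mul_apply, Fin.sum_univ_two, Matrix.star_apply] <;>
    first | ring1 | linear_combination h

theorem IsCompactForm.norm_column {u : tripleGroup d} (hu : IsCompactForm u) :
    ‖mat u 0 0‖ ^ 2 + ‖mat u 1 0‖ ^ 2 = 1 := by
  have h := Matrix.mem_unitaryGroup_iff'.mp hu.1
  have h2 := congrFun (congrFun h 0) 0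
  simp only [Matrix.mul_apply, Fin.sum_univ_two, Matrix.star_apply, Matrix.one_apply_eq,
    RCLike.star_def] at h2
  rw [Complex.conj_mul', Complex.conj_mul'] at h2
  exact_mod_cast h2

namespace Data

variable {m : ℕ} (D : Data m)

/-- The subset of `G_s` on which no entry of the first columns vanishes; it lies above the open
orbit. -/
def generic : Set D.Gs := {g | ∀ i, mat (g i) 0 0 ≠ 0 ∧ mat (g i) 1 0 ≠ 0}

theorem dense_generic : Dense D.generic := by
  have h := dense_pi (s := fun i => {g : tripleGroup (D.det i) | mat g 0 0 ≠ 0 ∧ mat g 1 0 ≠ 0})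
    Set.univ (fun i _ => dense_column_ne_zero)
  convert h using 1
  ext g
  simp [generic, Set.mem_pi]

theorem continuous_entry (i : Fin (m + 1)) (j k : Fin 2) :
    Continuous fun g : D.Gs => mat (g i) j k :=
  (continuous_mat_apply j k).comp (continuous_apply i)

theorem continuous_centralPart (i : Fin (m + 1)) (a : Fin (D.rk i)) :
    Continuous fun g : D.Gs => (((g i).1.2 a : ℂˣ) : ℂ) :=
  Units.continuous_val.comp ((continuous_central a).comp (continuous_apply i))

theorem continuous_toAmbient : Continuous D.toAmbient := by
  refine continuous_pi fun i => Continuous.prodMk ?_ ?_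
  · exact continuous_pi fun a => continuous_pi fun b => D.continuous_entry i a b
  · exact continuous_pi fun a => D.continuous_centralPart i a

theorem continuous_act (b : D.Gs) : Continuous fun g => D.act g b :=
  continuous_pi fun i => (continuous_const.mul (continuous_apply i)).mul continuous_const

variable {D}

theorem IsHolomorphic.continuous {f : D.Gs → ℂ} (hf : D.IsHolomorphic f) : Continuous f := by
  rw [continuous_iff_continuousAt]
  intro g
  obtain ⟨F, hF, e⟩ := hf g
  exact (hF.continuousAt.comp (f := D.toAmbient) D.continuous_toAmbient.continuousAt).congr
    (e.mono fun _ h => h.symm)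

theorem IsHolomorphic.analyticAt_comp {f : D.Gs → ℂ} (hf : D.IsHolomorphic f)
    {E : Type*} [NormedAddCommGroup E] [NormedSpace ℂ E] {φ : E → D.Gs} (hφ : Continuous φ)
    {x : E} (ha : AnalyticAt ℂ (fun y => D.toAmbient (φ y)) x) :
    AnalyticAt ℂ (fun y => f (φ y)) x := by
  obtain ⟨F, hF, e⟩ := hf (φ x)
  refine (AnalyticAt.comp (f := fun y => D.toAmbient (φ y)) hF ha).congr ?_
  exact (hφ.continuousAt.eventually e).mono fun _ h => h.symm

variable (D)

/-- The representative `(e^{z_ℓ E} s_ℓ, …, e^{z₁ E} s₁)` of the point with coordinates `z`. -/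
def rep (z : Fin (m + 1) → ℂ) : D.Gs := fun i => expE (z i) * refl

theorem mat_rep (z : Fin (m + 1) → ℂ) (i : Fin (m + 1)) :
    mat (D.rep z i) = !![z i, -1; 1, 0] := by
  rw [rep, mat_mul, mat_expE, mat_refl]
  simp

theorem central_rep (z : Fin (m + 1) → ℂ) (i : Fin (m + 1)) : (D.rep z i).1.2 = 1 :=
  mul_one _

theorem continuous_rep : Continuous D.rep := by
  refine continuous_pi fun i => continuous_of_mat (fun j k => ?_) ?_
  · simp only [mat_rep]
    fin_cases j <;> fin_cases k <;> simp <;> fun_prop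
  · simp only [central_rep]
    exact continuous_const

theorem analyticAt_toAmbient_rep (z : Fin (m + 1) → ℂ) :
    AnalyticAt ℂ (fun z => D.toAmbient (D.rep z)) z := by
  have h : (fun z => D.toAmbient (D.rep z)) = fun z i =>
      (fun a b => (!![z i, -1; 1, 0] : Matrix (Fin 2) (Fin 2) ℂ) a b, fun _ => 1) := by
    funext z i
    simp only [toAmbient, mat_rep, central_rep]
    rfl
  rw [h]
  refine AnalyticAt.pi fun i => AnalyticAt.prod (AnalyticAt.pi fun a => AnalyticAt.pi fun b => ?_)
    analyticAt_const
  have hz : AnalyticAt ℂ (fun z : Fin (m + 1) → ℂ => z i) z :=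
    (ContinuousLinearMap.proj (R := ℂ) (φ := fun _ : Fin (m + 1) => ℂ) i).analyticAt z
  fin_cases a <;> fin_cases b <;> simp [analyticAt_const, hz]

/-- The element of `∏ SU(2) ⊆ U_s` with given first columns. -/
def unitary (v : Fin (m + 1) → UnitColumn) : D.Gs := fun i => ofUnitColumn (v i)

theorem continuous_unitary : Continuous D.unitary :=
  continuous_pi fun i => continuous_ofUnitColumn.comp (continuous_apply i)

theorem unitary_mem_Us (v : Fin (m + 1) → UnitColumn) : D.unitary v ∈ D.Us :=
  fun i => isCompactForm_ofUnitColumn (v i)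

theorem mat_unitary_zero (v : Fin (m + 1) → UnitColumn) (i : Fin (m + 1)) :
    mat (D.unitary v i) 0 0 = (v i).1.1 := rfl

theorem mat_unitary_one (v : Fin (m + 1) → UnitColumn) (i : Fin (m + 1)) :
    mat (D.unitary v i) 1 0 = (v i).1.2 := rfl

theorem central_unitary (v : Fin (m + 1) → UnitColumn) (i : Fin (m + 1)) :
    (D.unitary v i).1.2 = 1 := rfl

theorem exists_bound_unitary {f : D.Gs → ℂ} (hf : Continuous f) :
    ∃ C, ∀ v, ‖f (D.unitary v)‖ ≤ C := by
  obtain ⟨C, hC⟩ := (isCompact_range (hf.comp D.continuous_unitary)).isBounded.exists_norm_le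
  exact ⟨C, fun v => hC _ ⟨v, rfl⟩⟩

/-! ### The affine coordinates as functions on the group -/

/-- The torus component of `g` with respect to `N w T N`, the representative `w` of the reflection
being normalized so that the first coordinate is the lower left entry of `gᵢ`, where this entry does
not vanish. -/
def lowerTorus (g : D.Gs) : D.Ts := fun i => torusPart (refl⁻¹ * g i)

/-- The part of `G_s` above the coordinate domain: no lower left entry vanishes. -/
def bigCell : Set D.Gs := {g | ∀ i, mat (g i) 1 0 ≠ 0}

/-- The coordinates `zᵢ` as functions on `G_s`. -/
def affineCoord (g : D.Gs) (i : Fin (m + 1)) : ℂ :=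
  mat (g i) 0 0 / mat (g i) 1 0 * ((D.weightChar (D.rootWeight i) (D.lowerTorus g) : ℂˣ) : ℂ)

/-- The sign `∏ᵢ (-1) ^ ⟨λᵢ, Hᵢ⟩` caused by `s² = -1` in `c^λ`. -/
def sign (lam : D.Weight) : ℂ := ∏ i, (-1 : ℂ) ^ lam i 0

variable {D}

theorem sign_ne_zero (lam : D.Weight) : D.sign lam ≠ 0 :=
  Finset.prod_ne_zero_iff.mpr fun i _ => zpow_ne_zero _ (by norm_num)

theorem norm_sign (lam : D.Weight) : ‖D.sign lam‖ = 1 := by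
  simp [sign, norm_prod, norm_zpow]

theorem generic_subset_bigCell : D.generic ⊆ D.bigCell := fun _ hg i => (hg i).2

theorem mat_refl_inv_mul {n : ℕ} {d : Fin n → ℤ} (g : tripleGroup d) :
    mat (refl⁻¹ * g) 0 0 = mat g 1 0 := by
  have h : mat g 1 0 = mat (refl * (refl⁻¹ * g)) 1 0 := by rw [mul_inv_cancel_left]
  rw [h, mat_mul refl, mat_refl]
  simp [Matrix.mul_apply, Fin.sum_univ_two]

theorem mat_refl_mul {n : ℕ} {d : Fin n → ℤ} (g : tripleGroup d) :
    mat (refl * g) 0 0 = - mat g 1 0 := by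
  rw [mat_mul refl, mat_refl]
  simp [Matrix.mul_apply, Fin.sum_univ_two]

theorem lowerTorus_zero {g : D.Gs} (hg : g ∈ D.bigCell) (i : Fin (m + 1)) :
    ((D.lowerTorus g i 0 : ℂˣ) : ℂ) = mat (g i) 1 0 := by
  rw [lowerTorus, torusPart_zero, mat_refl_inv_mul]
  rw [mat_refl_inv_mul]
  exact hg i

theorem tail_lowerTorus (g : D.Gs) (i : Fin (m + 1)) :
    Fin.tail (D.lowerTorus g i) = (g i).1.2 := by
  rw [lowerTorus, tail_torusPart]
  change (1 : Fin (D.rk i) → ℂˣ)⁻¹ * (g i).1.2 = _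
  rw [inv_one, one_mul]

theorem torus_ext {t t' : D.Ts} (h0 : ∀ i, ((t i 0 : ℂˣ) : ℂ) = t' i 0)
    (h1 : ∀ i, Fin.tail (t i) = Fin.tail (t' i)) : t = t' := by
  funext i a
  refine Fin.cases ?_ (fun b => ?_) a
  · exact Units.ext (h0 i)
  · exact congrFun (h1 i) b

theorem cSection_eq (lam : D.Weight) {g : D.Gs} (hg : g ∈ D.bigCell) :
    D.cSection lam g = D.sign lam * ((D.weightChar lam (D.lowerTorus g) : ℂˣ) : ℂ) := by
  rw [weightChar_apply, Units.coe_prod, sign, cSection, ← Finset.prod_mul_distrib]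
  refine Finset.prod_congr rfl fun i _ => ?_
  have h0 : ((torusPart (refl * g i) 0 : ℂˣ) : ℂ) = -1 * mat (g i) 1 0 := by
    rw [torusPart_zero, mat_refl_mul, neg_one_mul]
    rw [mat_refl_mul]
    exact neg_ne_zero.mpr (hg i)
  have h1 : Fin.tail (torusPart (refl * g i)) = (g i).1.2 := by
    rw [tail_torusPart]
    exact one_mul _
  rw [character_succ, character_succ, tail_lowerTorus, h1]
  push_cast
  rw [h0, lowerTorus_zero hg, mul_zpow, mul_assoc]

theorem Related.mem_bigCell {g g' : D.Gs} {w : D.Ts} (h : D.Related g g' w) :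
    g' ∈ D.bigCell ↔ g ∈ D.bigCell := by
  refine forall_congr' fun i => ?_
  rw [(h i).2.1]
  simp

theorem Related.lowerTorus {g g' : D.Gs} {w : D.Ts} (h : D.Related g g' w)
    (hg : g ∈ D.bigCell) : D.lowerTorus g' = D.lowerTorus g * w := by
  refine torus_ext (fun i => ?_) (fun i => ?_)
  · rw [lowerTorus_zero (h.mem_bigCell.mpr hg), (h i).2.1]
    simp [lowerTorus_zero hg]
  · rw [tail_lowerTorus, (h i).2.2, ← tail_lowerTorus]
    rfl

theorem Related.affineCoord {g g' : D.Gs} {w : D.Ts} (h : D.Related g g' w)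
    (hg : g ∈ D.bigCell) : D.affineCoord g' = D.affineCoord g := by
  funext i
  have := hg i
  rw [Data.affineCoord, Data.affineCoord, h.lowerTorus hg, map_mul, (h i).1, (h i).2.1]
  push_cast
  field_simp

theorem rep_mem_bigCell (z : Fin (m + 1) → ℂ) : D.rep z ∈ D.bigCell := fun i => by
  simp [mat_rep]

theorem lowerTorus_rep (z : Fin (m + 1) → ℂ) : D.lowerTorus (D.rep z) = 1 := by
  refine torus_ext (fun i => ?_) (fun i => ?_)
  · rw [lowerTorus_zero (rep_mem_bigCell z)]
    simp [mat_rep]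
  · rw [tail_lowerTorus, central_rep]
    rfl

theorem affineCoord_rep (z : Fin (m + 1) → ℂ) : D.affineCoord (D.rep z) = z := by
  funext i
  simp [affineCoord, lowerTorus_rep, mat_rep]

theorem related_rep {g : D.Gs} (hg : g ∈ D.bigCell) :
    D.Related g (D.rep (D.affineCoord g)) (D.lowerTorus g)⁻¹ := by
  intro i
  have := hg i
  have h0 := lowerTorus_zero hg i
  refine ⟨?_, ?_, ?_⟩
  · rw [mat_rep, map_inv, affineCoord]
    simp [h0]
    field_simp
  · rw [mat_rep]
    simp [h0, this]
  · rw [central_rep, ← tail_lowerTorus]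
    funext a
    simp [Fin.tail]

theorem proj_eq_chart {g : D.Gs} (hg : g ∈ D.bigCell) :
    D.proj g = D.chart (D.affineCoord g) :=
  proj_eq_iff.mpr ⟨_, related_rep hg⟩

theorem chart_injective : Function.Injective D.chart := by
  intro z z' h
  obtain ⟨w, hw⟩ := proj_eq_iff.mp (show D.proj (D.rep z) = D.proj (D.rep z') from h)
  rw [← affineCoord_rep z, ← affineCoord_rep z', hw.affineCoord (rep_mem_bigCell z)]

theorem coord_chart (z : Fin (m + 1) → ℂ) : D.coord (D.chart z) = z :=
  Function.leftInverse_invFun chart_injective z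

theorem coord_proj {g : D.Gs} (hg : g ∈ D.bigCell) : D.coord (D.proj g) = D.affineCoord g := by
  rw [proj_eq_chart hg, coord_chart]

theorem proj_mem_openOrbit {g : D.Gs} : D.proj g ∈ D.openOrbit ↔ g ∈ D.generic := by
  constructor
  · rintro ⟨z, hz, e⟩
    obtain ⟨w, hw⟩ := proj_eq_iff.mp (show D.proj (D.rep z) = D.proj g from e)
    intro i
    rw [(hw i).1, (hw i).2.1, mat_rep]
    have := hz i
    simpa using this
  · intro hg
    refine ⟨D.affineCoord g, fun i => ?_, (proj_eq_chart (generic_subset_bigCell hg)).symm⟩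
    exact mul_ne_zero (div_ne_zero (hg i).1 (hg i).2) (Units.ne_zero _)

/-! ### The monomial sections -/

variable (D) in
/-- The weight `λ + ∑ⱼ ηⱼ rootWeight j` through which `f_η`, apart from the factors
`(aᵢ / cᵢ) ^ ηᵢ`, depends on the torus component. -/
def totalWeight (lam : D.Weight) (η : Fin (m + 1) → ℤ) : D.Weight :=
  lam + ∑ j, η j • D.rootWeight j

variable (D) in
/-- The affine function `hᵢ(η) = ⟨λᵢ, Hᵢ⟩ + ∑_{j < i} ⟨rootWeight j, Hᵢ⟩ ηⱼ` bounding the `i`-th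
coordinate of the twisted cube. -/
def height (lam : D.Weight) (η : Fin (m + 1) → ℤ) (i : Fin (m + 1)) : ℤ :=
  D.totalWeight lam η i 0

theorem height_eq (lam : D.Weight) (η : Fin (m + 1) → ℤ) (i : Fin (m + 1)) :
    D.height lam η i = lam i 0 + ∑ j, D.rootWeight j i 0 * η j := by
  simp [height, totalWeight, mul_comm]

variable (D) in
/-- The holomorphic extension of `f_η`, provided that `0 ≤ ηᵢ ≤ hᵢ(η)`: up to a sign the product of
the `aᵢ ^ ηᵢ cᵢ ^ (hᵢ(η) - ηᵢ)`, with `(aᵢ, cᵢ)` the first column of `gᵢ`, and of a character of the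
central parts. -/
def cubeSection (lam : D.Weight) (η : Fin (m + 1) → ℤ) (g : D.Gs) : ℂ :=
  D.sign lam * ∏ i, mat (g i) 0 0 ^ (η i).toNat * mat (g i) 1 0 ^ (D.height lam η i - η i).toNat *
    ∏ b, (((g i).1.2 b : ℂˣ) : ℂ) ^ D.totalWeight lam η i b.succ

theorem monomialSection_eq (lam : D.Weight) (η : Fin (m + 1) → ℤ) {g : D.Gs}
    (hg : g ∈ D.generic) : D.monomialSection lam η g
      = D.sign lam * ∏ i, mat (g i) 0 0 ^ η i * mat (g i) 1 0 ^ (D.height lam η i - η i) *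
        ∏ b, (((g i).1.2 b : ℂˣ) : ℂ) ^ D.totalWeight lam η i b.succ := by
  have hg' := generic_subset_bigCell hg
  have h1 : ((D.weightChar (D.totalWeight lam η) (D.lowerTorus g) : ℂˣ) : ℂ)
      = ((D.weightChar lam (D.lowerTorus g) : ℂˣ) : ℂ) *
        ∏ j, ((D.weightChar (D.rootWeight j) (D.lowerTorus g) : ℂˣ) : ℂ) ^ η j := by
    rw [totalWeight, weightChar_add, weightChar_sum]
    simp only [weightChar_zsmul]
    push_cast
    rfl
  have h2 : ∀ i, D.affineCoord g i ^ η i = mat (g i) 0 0 ^ η i * mat (g i) 1 0 ^ (-η i) *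
      ((D.weightChar (D.rootWeight i) (D.lowerTorus g) : ℂˣ) : ℂ) ^ η i := by
    intro i
    rw [affineCoord, mul_zpow, div_zpow, zpow_neg, div_eq_mul_inv]
  have h3 : ((D.weightChar (D.totalWeight lam η) (D.lowerTorus g) : ℂˣ) : ℂ)
      = ∏ i, mat (g i) 1 0 ^ D.height lam η i *
        ∏ b, (((g i).1.2 b : ℂˣ) : ℂ) ^ D.totalWeight lam η i b.succ := by
    rw [weightChar_apply, Units.coe_prod]
    refine Finset.prod_congr rfl fun i _ => ?_
    rw [character_succ, tail_lowerTorus, Units.val_mul, Units.val_zpow_eq_zpow_val,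
      lowerTorus_zero hg', height]
    congr 1
    simp [character, Fin.tail]
  rw [monomialSection, coord_proj hg', cSection_eq lam hg']
  simp only [h2]
  rw [Finset.prod_mul_distrib, mul_left_comm, mul_assoc, mul_comm (∏ j, _ ^ η j), ← h1, h3,
    ← Finset.prod_mul_distrib]
  refine congrArg _ (Finset.prod_congr rfl fun i _ => ?_)
  have h4 : mat (g i) 1 0 ^ (-η i) * mat (g i) 1 0 ^ D.height lam η i
      = mat (g i) 1 0 ^ (D.height lam η i - η i) := by
    rw [← zpow_add₀ (hg i).2, neg_add_eq_sub]
  rw [← h4]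
  ring

theorem monomialSection_related (lam : D.Weight) (η : Fin (m + 1) → ℤ) {g g' : D.Gs} {w : D.Ts}
    (h : D.Related g g' w) (hg : g ∈ D.bigCell) : D.monomialSection lam η g'
      = D.monomialSection lam η g * ((D.weightChar lam w : ℂˣ) : ℂ) := by
  have hg' := h.mem_bigCell.mpr hg
  rw [monomialSection, monomialSection, coord_proj hg', coord_proj hg, h.affineCoord hg,
    cSection_eq lam hg', cSection_eq lam hg, h.lowerTorus hg, map_mul]
  push_cast
  ring

theorem cubeSection_eq {lam : D.Weight} {η : Fin (m + 1) → ℤ}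
    (hη : ∀ i, 0 ≤ η i ∧ η i ≤ D.height lam η i) {g : D.Gs} (hg : g ∈ D.generic) :
    D.cubeSection lam η g = D.monomialSection lam η g := by
  rw [monomialSection_eq lam η hg, cubeSection]
  refine congrArg _ (Finset.prod_congr rfl fun i _ => ?_)
  rw [← zpow_natCast, ← zpow_natCast, Int.toNat_of_nonneg (hη i).1,
    Int.toNat_of_nonneg (sub_nonneg.mpr (hη i).2)]

theorem isHolomorphic_cubeSection (lam : D.Weight) (η : Fin (m + 1) → ℤ) :
    D.IsHolomorphic (D.cubeSection lam η) := by
  intro g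
  refine ⟨fun x => D.sign lam * ∏ i, (x i).1 0 0 ^ (η i).toNat *
    (x i).1 1 0 ^ (D.height lam η i - η i).toNat *
    ∏ b, (x i).2 b ^ D.totalWeight lam η i b.succ, ?_, Eventually.of_forall fun h => rfl⟩
  have h1 : ∀ i j k, AnalyticAt ℂ (fun x : D.Ambient => (x i).1 j k) (D.toAmbient g) := by
    intro i j k
    exact ((ContinuousLinearMap.proj (R := ℂ) (φ := fun _ : Fin 2 => ℂ) k).comp
      ((ContinuousLinearMap.proj (R := ℂ) (φ := fun _ : Fin 2 => Fin 2 → ℂ) j).comp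
      ((ContinuousLinearMap.fst ℂ _ _).comp (ContinuousLinearMap.proj (R := ℂ)
        (φ := fun i => (Fin 2 → Fin 2 → ℂ) × (Fin (D.rk i) → ℂ)) i)))).analyticAt _
  have h2 : ∀ i b, AnalyticAt ℂ (fun x : D.Ambient => (x i).2 b) (D.toAmbient g) := by
    intro i b
    exact ((ContinuousLinearMap.proj (R := ℂ) (φ := fun _ : Fin (D.rk i) => ℂ) b).comp
      ((ContinuousLinearMap.snd ℂ _ _).comp (ContinuousLinearMap.proj (R := ℂ)
        (φ := fun i => (Fin 2 → Fin 2 → ℂ) × (Fin (D.rk i) → ℂ)) i))).analyticAt _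
  refine analyticAt_const.mul (Finset.analyticAt_fun_prod _ fun i _ => ?_)
  refine (((h1 i 0 0).pow _).mul ((h1 i 1 0).pow _)).mul
    (Finset.analyticAt_fun_prod _ fun b _ => (h2 i b).zpow ?_)
  exact Units.ne_zero _

/-- A continuous function that transforms like a section above the open orbit does so
everywhere. -/
theorem mem_sections_of_generic {lam : D.Weight} {f : D.Gs → ℂ} (hf : D.IsHolomorphic f)
    (h : ∀ g ∈ D.generic, ∀ b ∈ D.Bs, f (D.act g b) = f g * D.tildeCharacter lam b) :
    f ∈ D.sections lam := by
  refine ⟨hf, fun g b hb => ?_⟩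
  have := Continuous.ext_on D.dense_generic (hf.continuous.comp (D.continuous_act b))
    (hf.continuous.mul continuous_const) (fun g hg => h g hg b hb)
  exact congrFun this g

theorem cubeSection_mem {lam : D.Weight} {η : Fin (m + 1) → ℤ}
    (hη : ∀ i, 0 ≤ η i ∧ η i ≤ D.height lam η i) : D.cubeSection lam η ∈ D.sections lam := by
  refine mem_sections_of_generic (isHolomorphic_cubeSection lam η) fun g hg b hb => ?_
  have h := related_act g hb
  have hg' : D.act g b ∈ D.generic := by
    rw [← proj_mem_openOrbit, ← proj_eq_iff.mpr ⟨_, h⟩, proj_mem_openOrbit]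
    exact hg
  rw [cubeSection_eq hη hg', cubeSection_eq hη hg,
    monomialSection_related lam η h (generic_subset_bigCell hg), tildeCharacter_eq]

theorem isExtension_cubeSection {lam : D.Weight} {η : Fin (m + 1) → ℤ}
    (hη : ∀ i, 0 ≤ η i ∧ η i ≤ D.height lam η i) :
    D.IsExtension lam η (D.cubeSection lam η) :=
  fun _ hg => cubeSection_eq hη (proj_mem_openOrbit.mp hg)

variable (D)

/-! ### The unitary representative of a point -/

theorem norm_weightChar (M : D.Weight) (w : D.Ts) :
    ‖((D.weightChar M w : ℂˣ) : ℂ)‖ = ∏ k, ∏ a, ‖((w k a : ℂˣ) : ℂ)‖ ^ M k a := by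
  simp [weightChar_apply, character, norm_prod, norm_zpow]

theorem norm_weightChar_congr {M : D.Weight} {w w' : D.Ts}
    (h : ∀ k, M k ≠ 0 → ∀ a, ‖((w k a : ℂˣ) : ℂ)‖ = ‖((w' k a : ℂˣ) : ℂ)‖) :
    ‖((D.weightChar M w : ℂˣ) : ℂ)‖ = ‖((D.weightChar M w' : ℂˣ) : ℂ)‖ := by
  rw [norm_weightChar, norm_weightChar]
  refine Finset.prod_congr rfl fun k _ => Finset.prod_congr rfl fun a _ => ?_
  by_cases hk : M k = 0
  · simp [hk]
  · rw [h k hk a]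

/-- The positive factor by which the `i`-th first column is scaled in passing to a unitary
representative, computed from `i = ℓ` downwards. -/
def radius (g : D.Gs) (i : Fin (m + 1)) : ℝ :=
  √(‖mat (g i) 0 0‖ ^ 2 * (∏ k : Fin (m + 1), if _h : i < k then
      radius g k ^ D.rootWeight i k 0 *
        ∏ b : Fin (D.rk k), ‖(((g k).1.2 b : ℂˣ) : ℂ)‖ ^ D.rootWeight i k b.succ
    else 1) ^ 2 + ‖mat (g i) 1 0‖ ^ 2)
termination_by m - i.1
decreasing_by
  have := k.2
  have : i.1 < k.1 := _h
  omega

theorem radius_pos (g : D.Gs) (i : Fin (m + 1)) : 0 < D.radius g i := by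
  induction i using WellFoundedGT.induction with
  | ind i ih =>
    rw [radius, Real.sqrt_pos]
    have hP : 0 < ∏ k : Fin (m + 1), if i < k then D.radius g k ^ D.rootWeight i k 0 *
        ∏ b : Fin (D.rk k), ‖(((g k).1.2 b : ℂˣ) : ℂ)‖ ^ D.rootWeight i k b.succ else 1 := by
      refine Finset.prod_pos fun k _ => ?_
      split_ifs with h
      · exact mul_pos (zpow_pos (ih k h) _) (Finset.prod_pos fun b _ =>
          zpow_pos (norm_pos_iff.mpr (Units.ne_zero _)) _)
      · exact one_pos
    rcases column_ne_zero (g i) with h | h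
    · have := norm_pos_iff.mpr h
      positivity
    · have := norm_pos_iff.mpr h
      positivity

theorem continuous_radius (i : Fin (m + 1)) : Continuous fun g => D.radius g i := by
  induction i using WellFoundedGT.induction with
  | ind i ih =>
    simp only [radius.eq_1 D _ i]
    refine Real.continuous_sqrt.comp (((D.continuous_entry i 0 0).norm.pow 2).mul
      (Continuous.pow (continuous_finsetProd _ fun k _ => ?_) 2) |>.add
      ((D.continuous_entry i 1 0).norm.pow 2))
    split_ifs with h
    · refine ((ih k h).zpow₀ _ fun g => Or.inl (D.radius_pos g k).ne').mul
        (continuous_finsetProd _ fun b _ => ?_)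
      exact (D.continuous_centralPart k b).norm.zpow₀ _ fun g =>
        Or.inl (norm_pos_iff.mpr (Units.ne_zero _)).ne'
    · exact continuous_const

/-- The torus element whose inverse carries `g` to a unitary representative. -/
def polarTorus (g : D.Gs) : D.Ts := fun k =>
  Fin.cons (Units.mk0 (D.radius g k : ℂ) (by exact_mod_cast (D.radius_pos g k).ne')) (g k).1.2

theorem polarTorus_zero (g : D.Gs) (k : Fin (m + 1)) :
    ((D.polarTorus g k 0 : ℂˣ) : ℂ) = D.radius g k := rfl

theorem norm_polarTorus_zero (g : D.Gs) (k : Fin (m + 1)) :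
    ‖((D.polarTorus g k 0 : ℂˣ) : ℂ)‖ = D.radius g k := by
  rw [polarTorus_zero, Complex.norm_real, Real.norm_of_nonneg (D.radius_pos g k).le]

theorem tail_polarTorus (g : D.Gs) (k : Fin (m + 1)) :
    Fin.tail (D.polarTorus g k) = (g k).1.2 := rfl

theorem radius_sq (g : D.Gs) (i : Fin (m + 1)) : D.radius g i ^ 2 = ‖mat (g i) 0 0‖ ^ 2 *
    ‖((D.weightChar (D.rootWeight i) (D.polarTorus g) : ℂˣ) : ℂ)‖ ^ 2 + ‖mat (g i) 1 0‖ ^ 2 := by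
  rw [radius, Real.sq_sqrt (by positivity), norm_weightChar]
  congr 3
  refine Finset.prod_congr rfl fun k _ => ?_
  split_ifs with h
  · rw [Fin.prod_univ_succ, norm_polarTorus_zero]
    rfl
  · simp [D.rootWeight_eq_zero (not_lt.mp h)]

theorem lt_of_rootWeight_ne_zero {i k : Fin (m + 1)} (h : D.rootWeight i k ≠ 0) : i < k :=
  lt_of_not_ge fun hk => h (D.rootWeight_eq_zero hk)

variable {D}

theorem Related.radius {g g' : D.Gs} {w : D.Ts} (h : D.Related g g' w) (i : Fin (m + 1)) :
    D.radius g' i = D.radius g i * ‖((w i 0 : ℂˣ) : ℂ)‖ := by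
  induction i using WellFoundedGT.induction with
  | ind i ih =>
    have hw : ‖((D.weightChar (D.rootWeight i) (D.polarTorus g') : ℂˣ) : ℂ)‖
        = ‖((D.weightChar (D.rootWeight i) (D.polarTorus g * w) : ℂˣ) : ℂ)‖ := by
      refine D.norm_weightChar_congr fun k hk a => ?_
      refine Fin.cases ?_ (fun b => ?_) a
      · rw [norm_polarTorus_zero, ih k (D.lt_of_rootWeight_ne_zero hk)]
        simp only [Pi.mul_apply, Units.val_mul, norm_mul, norm_polarTorus_zero]
      · have : D.polarTorus g' k b.succ = (D.polarTorus g * w) k b.succ := by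
          change (g' k).1.2 b = (g k).1.2 b * w k b.succ
          rw [(h k).2.2]
          rfl
        rw [this]
    have h0 : 0 < ‖((w i 0 : ℂˣ) : ℂ)‖ := norm_pos_iff.mpr (Units.ne_zero _)
    refine (sq_eq_sq₀ (D.radius_pos g' i).le (mul_pos (D.radius_pos g i) h0).le).mp ?_
    have h1 : ‖((D.weightChar (D.rootWeight i) w : ℂˣ) : ℂ)‖ ≠ 0 :=
      (norm_pos_iff.mpr (Units.ne_zero _)).ne'
    rw [mul_pow, radius_sq, radius_sq, hw, map_mul, (h i).1, (h i).2.1]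
    simp only [Units.val_mul, norm_mul, norm_inv]
    field_simp

theorem radius_of_mem_Us {u : D.Gs} (hu : u ∈ D.Us) (i : Fin (m + 1)) : D.radius u i = 1 := by
  induction i using WellFoundedGT.induction with
  | ind i ih =>
    have hw : ‖((D.weightChar (D.rootWeight i) (D.polarTorus u) : ℂˣ) : ℂ)‖
        = ‖((D.weightChar (D.rootWeight i) 1 : ℂˣ) : ℂ)‖ := by
      refine D.norm_weightChar_congr fun k hk a => ?_
      refine Fin.cases ?_ (fun b => ?_) a
      · rw [norm_polarTorus_zero, ih k (D.lt_of_rootWeight_ne_zero hk)]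
        simp
      · have : D.polarTorus u k b.succ = (u k).1.2 b := rfl
        rw [this, (hu k).2 b]
        simp
    have h1 := radius_sq D u i
    rw [hw, map_one, Units.val_one, norm_one, one_pow, mul_one, (hu i).norm_column] at h1
    nlinarith [D.radius_pos u i]

theorem exists_related_unitary (g : D.Gs) :
    ∃ v, D.Related g (D.unitary v) (D.polarTorus g)⁻¹ := by
  have hr : ∀ i, (D.radius g i : ℂ) ≠ 0 := fun i => by exact_mod_cast (D.radius_pos g i).ne'
  refine ⟨fun i => ⟨(mat (g i) 0 0 * (D.radius g i : ℂ)⁻¹ *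
    ((D.weightChar (D.rootWeight i) (D.polarTorus g) : ℂˣ) : ℂ),
    mat (g i) 1 0 * (D.radius g i : ℂ)⁻¹), ?_⟩, fun i => ⟨?_, ?_, ?_⟩⟩
  · have h := D.radius_sq g i
    have h0 := (D.radius_pos g i).ne'
    simp only [norm_mul, norm_inv, Complex.norm_real, Real.norm_of_nonneg (D.radius_pos g i).le]
    field_simp
    linarith
  · rw [mat_unitary_zero, map_inv]
    simp [polarTorus_zero]
  · rw [mat_unitary_one]
    simp [polarTorus_zero]
  · rw [central_unitary]
    change 1 = (g i).1.2 * (Fin.tail (D.polarTorus g i))⁻¹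
    rw [tail_polarTorus, mul_inv_cancel]

/-- The squared absolute values of the upper entries of the first columns of a unitary
representative. -/
def moduli (g : D.Gs) (i : Fin (m + 1)) : ℝ := 1 - ‖mat (g i) 1 0‖ ^ 2 / D.radius g i ^ 2

theorem Related.moduli {g g' : D.Gs} {w : D.Ts} (h : D.Related g g' w) :
    Data.moduli g' = Data.moduli g := by
  funext i
  have h0 : ‖((w i 0 : ℂˣ) : ℂ)‖ ≠ 0 := (norm_pos_iff.mpr (Units.ne_zero _)).ne'
  have := (D.radius_pos g i).ne'
  rw [Data.moduli, Data.moduli, (h i).2.1, h.radius, norm_mul]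
  field_simp

theorem continuous_moduli : Continuous (moduli (D := D)) := by
  refine continuous_pi fun i => continuous_const.sub ?_
  exact ((D.continuous_entry i 1 0).norm.pow 2).div ((D.continuous_radius i).pow 2)
    fun g => (pow_pos (D.radius_pos g i) 2).ne'

theorem moduli_mem (g : D.Gs) (i : Fin (m + 1)) : moduli g i ∈ Set.Icc (0 : ℝ) 1 := by
  have h := D.radius_sq g i
  have h0 := pow_pos (D.radius_pos g i) 2
  refine ⟨?_, ?_⟩
  · rw [moduli, sub_nonneg, div_le_one h0, h]
    exact le_add_of_nonneg_left (by positivity)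
  · rw [moduli, sub_le_self_iff]
    positivity

theorem exists_moduli_eq {p : Fin (m + 1) → ℝ} (hp : ∀ i, p i ∈ Set.Icc (0 : ℝ) 1) :
    ∃ g : D.Gs, moduli g = p := by
  refine ⟨D.unitary fun i => ⟨((√(p i) : ℝ), (√(1 - p i) : ℝ)), ?_⟩, funext fun i => ?_⟩
  · simp [Real.sq_sqrt (hp i).1, Real.sq_sqrt (sub_nonneg.mpr (hp i).2)]
  · rw [moduli, radius_of_mem_Us (D.unitary_mem_Us _), mat_unitary_one]
    simp [Real.sq_sqrt (sub_nonneg.mpr (hp i).2)]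

/-! ### The Kähler potential -/

theorem fiberNorm_cSection (lam : D.Weight) {g : D.Gs} (hg : g ∈ D.bigCell) :
    D.fiberNorm (D.cSection lam) (D.proj g) = ∏ i, (‖mat (g i) 1 0‖ / D.radius g i) ^ lam i 0 := by
  have hex : ∃ u ∈ D.Us, D.proj u = D.proj g := by
    obtain ⟨v, hv⟩ := exists_related_unitary g
    exact ⟨_, D.unitary_mem_Us v, (proj_eq_iff.mpr ⟨_, hv⟩).symm⟩
  rw [fiberNorm, dif_pos hex]
  obtain ⟨hu, e⟩ := hex.choose_spec
  set u := hex.choose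
  obtain ⟨w, hw⟩ := proj_eq_iff.mp e.symm
  have huc := hw.mem_bigCell.mpr hg
  rw [cSection_eq lam huc, norm_mul, norm_sign, one_mul, norm_weightChar]
  refine Finset.prod_congr rfl fun i _ => ?_
  have h1 : ∀ b : Fin (D.rk i), ‖((D.lowerTorus u i b.succ : ℂˣ) : ℂ)‖ = 1 := by
    intro b
    have h2 : D.lowerTorus u i b.succ = (u i).1.2 b := congrFun (tail_lowerTorus u i) b
    rw [h2, (hu i).2 b]
  rw [Fin.prod_univ_succ, lowerTorus_zero huc]
  simp only [h1, one_zpow, Finset.prod_const_one, mul_one]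
  congr 1
  have h3 := hw.radius i
  rw [radius_of_mem_Us hu] at h3
  rw [(hw i).2.1, norm_mul, div_eq_mul_inv]
  congr 1
  exact eq_inv_of_mul_eq_one_right h3.symm

theorem potential_chart (lam : D.Weight) (z : Fin (m + 1) → ℂ) :
    D.potential lam (D.chart z) = ∑ i, (lam i 0 : ℝ) * Real.log (D.radius (D.rep z) i ^ 2) := by
  have h := fiberNorm_cSection lam (rep_mem_bigCell (D := D) z)
  have hp := fun i => D.radius_pos (D.rep z) i
  change -Real.log (D.fiberNorm _ (D.proj (D.rep z)) ^ 2) = _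
  rw [h, Real.log_pow, Real.log_prod fun i _ => zpow_ne_zero _ (by simp [mat_rep, (hp i).ne'])]
  simp only [mat_rep, Real.log_zpow, Real.log_pow]
  simp [Finset.mul_sum, Real.log_inv]
  refine Finset.sum_congr rfl fun i _ => ?_
  ring

theorem norm_weightChar_polarTorus_rep (M : D.Weight) (z : Fin (m + 1) → ℂ) :
    ‖((D.weightChar M (D.polarTorus (D.rep z)) : ℂˣ) : ℂ)‖
      = ∏ k, D.radius (D.rep z) k ^ M k 0 := by
  rw [norm_weightChar]
  refine Finset.prod_congr rfl fun k _ => ?_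
  have h1 : ∀ b : Fin (D.rk k), D.polarTorus (D.rep z) k b.succ = 1 := fun b =>
    congrFun (central_rep D z k) b
  rw [Fin.prod_univ_succ, norm_polarTorus_zero]
  simp [h1]

theorem radius_rep_sq (z : Fin (m + 1) → ℂ) (i : Fin (m + 1)) :
    D.radius (D.rep z) i ^ 2
      = ‖z i‖ ^ 2 * (∏ k, (D.radius (D.rep z) k ^ 2) ^ D.rootWeight i k 0) + 1 := by
  rw [radius_sq, norm_weightChar_polarTorus_rep, ← Finset.prod_pow]
  simp [mat_rep]
  refine Or.inl (Finset.prod_congr rfl fun k _ => ?_)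
  rw [← zpow_natCast, ← zpow_natCast, zpow_comm]

variable (D)

/-! ### The moment map -/

/-- The action variables as functions of `pᵢ ∈ [0, 1]`, through the recursion
`Jᵢ = pᵢ (⟨λᵢ, Hᵢ⟩ + ∑_{j < i} ⟨rootWeight j, Hᵢ⟩ Jⱼ)`. -/
def actions (lam : D.Weight) (p : Fin (m + 1) → ℝ) (i : Fin (m + 1)) : ℝ :=
  p i * (lam i 0 + ∑ j : Fin (m + 1),
    if _h : j < i then (D.rootWeight j i 0 : ℝ) * actions lam p j else 0)
termination_by i.1

theorem actions_eq (lam : D.Weight) (p : Fin (m + 1) → ℝ) (i : Fin (m + 1)) :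
    D.actions lam p i
      = p i * (lam i 0 + ∑ j, (D.rootWeight j i 0 : ℝ) * D.actions lam p j) := by
  rw [actions]
  congr 2
  refine Finset.sum_congr rfl fun j _ => ?_
  split_ifs with h
  · rfl
  · simp [D.rootWeight_eq_zero (not_lt.mp h)]

theorem continuous_actions (lam : D.Weight) : Continuous (D.actions lam) := by
  refine continuous_pi fun i => ?_
  induction i using WellFoundedLT.induction with
  | ind i ih =>
    simp only [actions.eq_1 D lam _ i]
    refine (continuous_apply i).mul (continuous_const.add (continuous_finsetSum _ fun j _ => ?_))
    split_ifs with h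
    · exact continuous_const.mul (ih j h)
    · exact continuous_const

theorem actions_congr (lam : D.Weight) {p p' : Fin (m + 1) → ℝ} {i : Fin (m + 1)}
    (h : ∀ j ≤ i, p j = p' j) : D.actions lam p i = D.actions lam p' i := by
  induction i using WellFoundedLT.induction with
  | ind i ih =>
    rw [actions, actions, h i le_rfl]
    congr 2
    refine Finset.sum_congr rfl fun j _ => ?_
    split_ifs with hj
    · rw [ih j hj fun k hk => h k (hk.trans hj.le)]
    · rfl

variable {D}

/-- The logarithms `Lₖ = log rₖ²` satisfy `Lₖ = log (1 + exp (θₖ))`, where `θₖ` is the sum of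
`log |zₖ|²` and a linear function of the `L_l` with `l > k`. -/
theorem log_radius_rep {z : Fin (m + 1) → ℂ} {k : Fin (m + 1)} (hz : z k ≠ 0) :
    Real.log (D.radius (D.rep z) k ^ 2) = Real.log (Real.exp (Real.log (‖z k‖ ^ 2) +
      ∑ l, (D.rootWeight k l 0 : ℝ) * Real.log (D.radius (D.rep z) l ^ 2)) + 1) := by
  have hr : ∀ l, 0 < D.radius (D.rep z) l ^ 2 := fun l => pow_pos (D.radius_pos _ l) 2
  have hz' : 0 < ‖z k‖ ^ 2 := pow_pos (norm_pos_iff.mpr hz) 2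
  rw [radius_rep_sq, Real.exp_add, Real.exp_log hz', Real.exp_sum]
  congr 4
  funext l
  rw [← Real.log_zpow, Real.exp_log (zpow_pos (hr l) _)]

theorem moduli_rep {z : Fin (m + 1) → ℂ} (k : Fin (m + 1)) :
    moduli (D.rep z) k = 1 - (D.radius (D.rep z) k ^ 2)⁻¹ := by
  simp [moduli, mat_rep]

/-- The logarithmic derivatives `νₖ` of the `rₖ²` in the direction of `τᵢ` satisfy the recursion
dual to the one of the action variables. -/
theorem exists_hasDerivAt_log_radius {z : Fin (m + 1) → ℂ} (hz : ∀ k, z k ≠ 0)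
    (i : Fin (m + 1)) : ∃ ν : Fin (m + 1) → ℝ,
    (∀ k, HasDerivAt (fun t : ℝ => Real.log (D.radius (D.rep
      (Function.update z i ((Real.exp t : ℂ) * z i))) k ^ 2)) (ν k) 0) ∧
    ∀ k, ν k = moduli (D.rep z) k *
      ((if k = i then 2 else 0) + ∑ l, (D.rootWeight k l 0 : ℝ) * ν l) := by
  set c : ℝ → Fin (m + 1) → ℂ := fun t => Function.update z i ((Real.exp t : ℂ) * z i) with hc
  set L : Fin (m + 1) → ℝ → ℝ := fun k t => Real.log (D.radius (D.rep (c t)) k ^ 2) with hL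
  have hc0 : c 0 = z := by simp [hc]
  have hcne : ∀ t k, c t k ≠ 0 := by
    intro t k
    by_cases hk : k = i
    · subst hk
      simp [hc, hz]
    · simp [hc, hk, hz]
  have hlog : ∀ t k, Real.log (‖c t k‖ ^ 2)
      = Real.log (‖z k‖ ^ 2) + (if k = i then 2 else 0) * t := by
    intro t k
    by_cases hk : k = i
    · subst hk
      simp only [hc, Function.update_self, norm_mul, Complex.norm_real, Real.norm_eq_abs,
        Real.abs_exp, mul_pow, if_true]
      rw [Real.log_mul (by positivity) (by simp [hz]), Real.log_pow, Real.log_exp]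
      push_cast
      ring
    · simp [hc, hk]
  have hLeq : ∀ k, L k = fun t => Real.log (Real.exp (Real.log (‖z k‖ ^ 2) +
      (if k = i then 2 else 0) * t + ∑ l, (D.rootWeight k l 0 : ℝ) * L l t) + 1) := by
    intro k
    funext t
    rw [← hlog]
    exact log_radius_rep (hcne t k)
  have step : ∀ k, (∀ l, k < l → DifferentiableAt ℝ (L l) 0) →
      HasDerivAt (L k) (moduli (D.rep z) k *
      ((if k = i then 2 else 0) + ∑ l, (D.rootWeight k l 0 : ℝ) * deriv (L l) 0)) 0 := by
    intro k ih
    have h1 : HasDerivAt (fun t : ℝ => Real.log (‖z k‖ ^ 2) +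
        (if k = i then 2 else 0) * t + ∑ l, (D.rootWeight k l 0 : ℝ) * L l t)
        ((if k = i then 2 else 0) + ∑ l, (D.rootWeight k l 0 : ℝ) * deriv (L l) 0) 0 := by
      refine HasDerivAt.add ?_ (HasDerivAt.fun_sum fun l _ => ?_)
      · simpa using ((hasDerivAt_id (0 : ℝ)).const_mul (if k = i then (2 : ℝ) else 0)).const_add
          (Real.log (‖z k‖ ^ 2))
      · by_cases hl : k < l
        · exact (ih l hl).hasDerivAt.const_mul _
        · simp only [D.rootWeight_eq_zero (not_lt.mp hl), Pi.zero_apply, Int.cast_zero, zero_mul]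
          exact hasDerivAt_const _ _
    have h2 := (h1.exp.add_const 1).log (by positivity)
    rw [hLeq k]
    convert h2 using 1
    have h3 : Real.exp (Real.log (‖z k‖ ^ 2) + (if k = i then 2 else 0) * 0 +
        ∑ l, (D.rootWeight k l 0 : ℝ) * L l 0) + 1 = D.radius (D.rep z) k ^ 2 := by
      have h4 := congrFun (hLeq k) 0
      simp only [hL, hc0] at h4
      refine (Real.log_injOn_pos (Set.mem_Ioi.mpr (pow_pos (D.radius_pos _ k) 2))
        (Set.mem_Ioi.mpr (by positivity)) ?_).symm
      simpa only [hL, hc0] using h4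
    have h5 : D.radius (D.rep z) k ≠ 0 := (D.radius_pos _ k).ne'
    rw [h3, eq_sub_of_add_eq h3, moduli_rep]
    field_simp
  have hd : ∀ k, DifferentiableAt ℝ (L k) 0 := by
    intro k
    induction k using WellFoundedGT.induction with
    | ind k ih => exact (step k ih).differentiableAt
  exact ⟨fun k => deriv (L k) 0, fun k => (hd k).hasDerivAt,
    fun k => (step k fun l _ => hd l).deriv⟩

theorem actionVariable_eq (lam : D.Weight) {z : Fin (m + 1) → ℂ} (hz : ∀ k, z k ≠ 0) :
    D.actionVariable lam z = D.actions lam (moduli (D.rep z)) := by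
  funext i
  obtain ⟨ν, hν, hrec⟩ := exists_hasDerivAt_log_radius (D := D) hz i
  have h1 : HasDerivAt (fun t : ℝ => D.potential lam (D.chart
      (Function.update z i ((Real.exp t : ℂ) * z i)))) (∑ k, (lam k 0 : ℝ) * ν k) 0 := by
    simp only [potential_chart]
    exact HasDerivAt.fun_sum fun k _ => (hν k).const_mul _
  rw [actionVariable, h1.deriv]
  set p := moduli (D.rep z)
  set J := D.actions lam p with hJ
  have hJrec : ∀ k, J k = p k * (lam k 0 + ∑ j, (D.rootWeight j k 0 : ℝ) * J j) :=
    fun k => D.actions_eq lam p k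
  -- The recursions for `J` and `ν` have transposed coefficient matrices, so that the double sums
  -- arising from `λₖ νₖ = λₖ pₖ Xₖ` cancel.
  set X : Fin (m + 1) → ℝ := fun k =>
    (if k = i then 2 else 0) + ∑ l, (D.rootWeight k l 0 : ℝ) * ν l with hX
  have h2 : ∀ k, (lam k 0 : ℝ) * ν k
      = J k * X k - ∑ j, (D.rootWeight j k 0 : ℝ) * J j * ν k := by
    intro k
    have h3 : ν k = p k * X k := hrec k
    rw [← Finset.sum_mul, h3, hJrec k]
    ring
  have h4 : ∀ j, J j * X j
      = J j * (if j = i then 2 else 0) + ∑ k, (D.rootWeight j k 0 : ℝ) * J j * ν k := by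
    intro j
    rw [hX, mul_add, Finset.mul_sum]
    exact congrArg _ (Finset.sum_congr rfl fun k _ => by ring)
  rw [Finset.sum_congr rfl fun k _ => h2 k, Finset.sum_sub_distrib, Finset.sum_comm,
    ← Finset.sum_sub_distrib]
  simp only [h4, add_sub_cancel_right]
  simp
  ring

theorem dense_openOrbit : Dense D.openOrbit := by
  have h : Dense (D.proj '' D.generic) :=
    (Quotient.mk_surjective.denseRange).dense_image continuous_quotient_mk' D.dense_generic
  refine h.mono ?_
  rintro _ ⟨g, hg, rfl⟩
  exact proj_mem_openOrbit.mpr hg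

theorem momentMap_proj (lam : D.Weight) (g : D.Gs) :
    D.momentMap lam (D.proj g) = D.actions lam (moduli g) := by
  have hinv : ∀ g g' : D.Gs, D.orbitSetoid g g' →
      D.actions lam (moduli g) = D.actions lam (moduli g') := by
    intro g g' h
    obtain ⟨w, hw⟩ := proj_eq_iff.mp (Quotient.sound h : D.proj g = D.proj g')
    rw [hw.moduli]
  let Φ : D.X → Fin (m + 1) → ℝ := Quotient.lift (fun g => D.actions lam (moduli g)) hinv
  have hΦ : Continuous Φ := ((D.continuous_actions lam).comp continuous_moduli).quotient_lift hinv
  refine extendFrom_eq (dense_openOrbit _) ?_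
  refine (hΦ.continuousWithinAt (x := D.proj g)).congr' ?_
  filter_upwards [self_mem_nhdsWithin] with ξ hξ
  obtain ⟨z, hz, rfl⟩ := hξ
  rw [coord_chart, actionVariable_eq lam hz]
  rfl

/-- Under the positivity condition the image of the moment map is the twisted cube. -/
theorem range_momentMap {lam : D.Weight} (hpos : D.PositivityCondition lam)
    (J : Fin (m + 1) → ℝ) : J ∈ Set.range (D.momentMap lam) ↔
      ∀ i, 0 ≤ J i ∧ J i ≤ lam i 0 + ∑ j, (D.rootWeight j i 0 : ℝ) * J j := by
  have hpos' : ∀ p : Fin (m + 1) → ℝ, (∀ i, p i ∈ Set.Icc (0 : ℝ) 1) →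
      ∀ i, 0 ≤ D.actions lam p i := by
    intro p hp i
    obtain ⟨g, rfl⟩ := exists_moduli_eq (D := D) hp
    rw [← momentMap_proj]
    exact hpos _ _
  constructor
  · rintro ⟨ξ, rfl⟩ i
    obtain ⟨g, rfl⟩ := Quotient.mk_surjective ξ
    change 0 ≤ D.momentMap lam (D.proj g) i ∧ D.momentMap lam (D.proj g) i ≤
      lam i 0 + ∑ j, (D.rootWeight j i 0 : ℝ) * D.momentMap lam (D.proj g) j
    rw [momentMap_proj]
    have hp := moduli_mem g
    set p := moduli g
    refine ⟨hpos' p hp i, ?_⟩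
    -- At the point with `pᵢ` replaced by `1` the `i`-th action variable is the upper bound.
    have h1 : 0 ≤ (lam i 0 : ℝ) + ∑ j, (D.rootWeight j i 0 : ℝ) * D.actions lam p j := by
      have h2 := hpos' (Function.update p i 1) (fun k => by
        by_cases hk : k = i
        · subst hk; simp
        · simpa [hk] using hp k) i
      rw [actions_eq, Function.update_self, one_mul] at h2
      convert h2 using 3 with j
      by_cases hj : j < i
      · congr 1
        refine D.actions_congr lam fun k hk => ?_
        rw [Function.update_of_ne (hk.trans_lt hj).ne]
      · simp [D.rootWeight_eq_zero (not_lt.mp hj)]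
    rw [actions_eq]
    exact mul_le_of_le_one_left h1 (hp i).2
  · intro h
    set H : Fin (m + 1) → ℝ := fun i => lam i 0 + ∑ j, (D.rootWeight j i 0 : ℝ) * J j with hH
    obtain ⟨g, hg⟩ := exists_moduli_eq (D := D) (p := fun i => J i / H i) fun i =>
      ⟨div_nonneg (h i).1 ((h i).1.trans (h i).2), div_le_one_of_le₀ (h i).2
        ((h i).1.trans (h i).2)⟩
    refine ⟨D.proj g, ?_⟩
    rw [momentMap_proj, hg]
    funext i
    induction i using WellFoundedLT.induction with
    | ind i ih =>
      have h1 : (lam i 0 : ℝ) + ∑ j, (D.rootWeight j i 0 : ℝ) *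
          D.actions lam (fun i => J i / H i) j = H i := by
        refine congrArg _ (Finset.sum_congr rfl fun j _ => ?_)
        by_cases hj : j < i
        · rw [ih j hj]
        · simp [D.rootWeight_eq_zero (not_lt.mp hj)]
      rw [actions_eq, h1]
      -- If `Hᵢ = 0`, then `Jᵢ = 0` as well.
      by_cases h0 : H i = 0
      · have : J i = 0 := le_antisymm ((h i).2.trans h0.le) (h i).1
        simp [h0, this]
      · exact div_mul_cancel₀ _ h0

end Data

/-! ### Polynomials: growth and coefficients -/

/-- An entire function of polynomial growth is a polynomial. -/
theorem exists_polynomial_of_growth {f : ℂ → ℂ} (hf : Differentiable ℂ f) {C : ℝ} {N : ℕ}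
    (hC : ∀ z, ‖f z‖ ≤ C * (1 + ‖z‖) ^ N) :
    ∃ p : Polynomial ℂ, p.degree < (N + 1 : ℕ) ∧ ∀ z, f z = p.eval z := by
  have hvan : ∀ k, N < k → iteratedDeriv k f 0 = 0 := by
    intro k hk
    have hb : ∀ R : ℝ, 1 ≤ R → ‖iteratedDeriv k f 0‖ ≤ (k.factorial * (C * 2 ^ N)) / R := by
      intro R hR
      have hR0 : 0 < R := by linarith
      have hC0 : 0 ≤ C := by simpa using (norm_nonneg _).trans (hC 0)
      have h1 := Complex.norm_iteratedDeriv_le_of_forall_mem_sphere_norm_le (c := 0) k hR0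
        hf.diffContOnCl (C := C * (2 * R) ^ N) (fun z hz => by
          refine (hC z).trans ?_
          have : ‖z‖ = R := by simpa using hz
          rw [this]
          gcongr
          linarith)
      refine h1.trans ?_
      rw [div_le_div_iff₀ (by positivity) hR0]
      have h2 : R ^ (N + 1) ≤ R ^ k := pow_le_pow_right₀ hR hk
      calc k.factorial * (C * (2 * R) ^ N) * R = k.factorial * (C * 2 ^ N) * R ^ (N + 1) := by
            rw [mul_pow]; ring
        _ ≤ k.factorial * (C * 2 ^ N) * R ^ k := by gcongr
    have hlim : Tendsto (fun R : ℝ => (k.factorial * (C * 2 ^ N)) / R) atTop (𝓝 0) :=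
      tendsto_const_nhds.div_atTop tendsto_id
    exact norm_le_zero_iff.mp
      (ge_of_tendsto hlim ((eventually_ge_atTop 1).mono fun R hR => hb R hR))
  refine ⟨∑ k ∈ Finset.range (N + 1),
    Polynomial.C ((k.factorial : ℂ)⁻¹ * iteratedDeriv k f 0) * Polynomial.X ^ k, ?_, fun z => ?_⟩
  · rw [Polynomial.degree_lt_iff_coeff_zero]
    intro j hj
    rw [Polynomial.finsetSum_coeff]
    refine Finset.sum_eq_zero fun k hk => ?_
    rw [Polynomial.coeff_C_mul_X_pow, if_neg]
    have := Finset.mem_range.mp hk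
    omega
  · have h1 := Complex.hasSum_taylorSeries_of_entire hf 0 z
    have h2 := hasSum_sum_of_ne_finset_zero (L := SummationFilter.unconditional ℕ)
      (s := Finset.range (N + 1))
      (f := fun n : ℕ => (n.factorial : ℂ)⁻¹ • (z - 0) ^ n • iteratedDeriv n f 0) (fun k hk => by
        rw [hvan k (by simpa using hk)]
        simp)
    rw [h1.unique h2, Polynomial.eval_finsetSum]
    refine Finset.sum_congr rfl fun k _ => ?_
    simp
    ring

/-- A function of `n` variables that is polynomial of bounded degree in each variable is
polynomial, by Lagrange interpolation in one variable after the other. -/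
theorem exists_mvPolynomial_of_separately {n N : ℕ} (f : (Fin n → ℂ) → ℂ)
    (hf : ∀ z i, ∃ p : Polynomial ℂ, p.degree < N ∧
      ∀ t, f (Function.update z i t) = p.eval t) :
    ∃ P : MvPolynomial (Fin n) ℂ, ∀ z, f z = MvPolynomial.eval z P := by
  induction n with
  | zero =>
    refine ⟨MvPolynomial.C (f 0), fun z => ?_⟩
    rw [Subsingleton.elim z 0]
    simp
  | succ n ih =>
    have h1 : ∀ k : ℕ, ∃ P : MvPolynomial (Fin n) ℂ,
        ∀ y, f (Fin.cons (k : ℂ) y) = MvPolynomial.eval y P := by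
      intro k
      refine ih (fun y => f (Fin.cons (k : ℂ) y)) fun z i => ?_
      obtain ⟨p, hp, hp'⟩ := hf (Fin.cons (k : ℂ) z) i.succ
      refine ⟨p, hp, fun t => ?_⟩
      rw [← hp', Fin.cons_update]
    choose P hP using h1
    have hinj : Set.InjOn (fun k : ℕ => (k : ℂ)) (Finset.range N : Set ℕ) :=
      fun a _ b _ h => Nat.cast_injective h
    refine ⟨∑ k ∈ Finset.range N, MvPolynomial.rename Fin.succ (P k) *
      Polynomial.aeval (MvPolynomial.X 0)
        (Lagrange.basis (Finset.range N) (fun k : ℕ => (k : ℂ)) k), fun z => ?_⟩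
    obtain ⟨p, hp, hp'⟩ := hf z 0
    have h2 := Lagrange.eq_interpolate (s := Finset.range N) hinj (f := p) (by simpa using hp)
    have h3 : f z = p.eval (z 0) := by rw [← hp', Function.update_eq_self]
    rw [h3, h2, Lagrange.interpolate_apply, Polynomial.eval_finsetSum, map_sum]
    refine Finset.sum_congr rfl fun k _ => ?_
    have h4 : p.eval (k : ℂ) = MvPolynomial.eval (Fin.tail z) (P k) := by
      rw [← hP, ← hp']
      congr 1
      funext i
      refine Fin.cases ?_ (fun j => ?_) i
      · simp
      · simp [Fin.tail]
    have h5 : (MvPolynomial.eval z).comp (algebraMap ℂ (MvPolynomial (Fin (n + 1)) ℂ))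
        = RingHom.id ℂ := by
      ext
      simp
    rw [Polynomial.eval_mul, Polynomial.eval_C, map_mul, h4, MvPolynomial.eval_rename,
      Polynomial.aeval_def, Polynomial.hom_eval₂, h5, MvPolynomial.eval_X, Polynomial.eval₂_id]
    rfl

/-- Cauchy's estimate for the coefficients of a polynomial, by averaging over roots of unity. -/
theorem norm_coeff_mul_le {n : ℕ} (P : MvPolynomial (Fin n) ℂ) (z : Fin n → ℂ) {B : ℝ}
    (hB : ∀ ζ : Fin n → ℂ, (∀ i, ‖ζ i‖ = 1) →
      ‖MvPolynomial.eval (fun i => ζ i * z i) P‖ ≤ B) (α : Fin n →₀ ℕ) :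
    ‖P.coeff α‖ * ∏ i, ‖z i‖ ^ α i ≤ B := by
  by_cases hα : α ∈ P.support
  swap
  · rw [MvPolynomial.notMem_support_iff.mp hα, norm_zero, zero_mul]
    exact (norm_nonneg _).trans (hB 1 (by simp))
  set K := P.totalDegree + 1 with hK
  have hdeg : ∀ β ∈ P.support, ∀ i, β i < K := fun β hβ i =>
    Nat.lt_succ_of_le ((Finsupp.le_degree i β).trans (MvPolynomial.le_totalDegree hβ))
  set ω : ℂ := Complex.exp (2 * Real.pi * Complex.I / (K : ℕ)) with hω
  have hprim : IsPrimitiveRoot ω K := Complex.isPrimitiveRoot_exp K (by omega)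
  have hω1 : ‖ω‖ = 1 := hprim.norm'_eq_one (by omega)
  have hω0 : ω ≠ 0 := hprim.ne_zero (by omega)
  have hgeom : ∀ β ∈ P.support, ∀ i, ∑ k : Fin K, (ω ^ β i * (ω ^ α i)⁻¹) ^ (k : ℕ)
      = if β i = α i then (K : ℂ) else 0 := by
    intro β hβ i
    rw [Fin.sum_univ_eq_sum_range (fun k => (ω ^ β i * (ω ^ α i)⁻¹) ^ k) K]
    split_ifs with h
    · rw [h, mul_inv_cancel₀ (pow_ne_zero _ hω0)]
      simp
    · have hx : ω ^ β i * (ω ^ α i)⁻¹ ≠ 1 := by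
        intro h1
        refine h (hprim.pow_inj (hdeg β hβ i) (hdeg α hα i) ?_)
        rwa [mul_inv_eq_one₀ (pow_ne_zero _ hω0)] at h1
      have hx1 : (ω ^ β i * (ω ^ α i)⁻¹) ^ K = 1 := by
        rw [mul_pow, inv_pow, ← pow_mul, ← pow_mul, mul_comm (β i), mul_comm (α i), pow_mul,
          pow_mul, hprim.pow_eq_one]
        simp
      rw [geom_sum_eq hx, hx1]
      simp
  have key : ∑ k : Fin n → Fin K, (∏ i, ((ω ^ α i)⁻¹) ^ (k i : ℕ)) *
      MvPolynomial.eval (fun i => ω ^ (k i : ℕ) * z i) P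
      = (K : ℂ) ^ n * (P.coeff α * ∏ i, z i ^ α i) := by
    simp only [MvPolynomial.eval_eq', Finset.mul_sum]
    rw [Finset.sum_comm]
    have h1 : ∀ β ∈ P.support, ∑ k : Fin n → Fin K, (∏ i, ((ω ^ α i)⁻¹) ^ (k i : ℕ)) *
        (P.coeff β * ∏ i, (ω ^ (k i : ℕ) * z i) ^ β i)
        = (∏ i, if β i = α i then (K : ℂ) else 0) * (P.coeff β * ∏ i, z i ^ β i) := by
      intro β hβ
      rw [Finset.prod_congr rfl fun i _ => (hgeom β hβ i).symm, Finset.prod_univ_sum,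
        Fintype.piFinset_univ, Finset.sum_mul]
      refine Finset.sum_congr rfl fun k _ => ?_
      rw [mul_left_comm, mul_left_comm (∏ i, _), ← Finset.prod_mul_distrib,
        ← Finset.prod_mul_distrib]
      refine congrArg _ (Finset.prod_congr rfl fun i _ => ?_)
      rw [mul_pow, mul_pow, ← pow_mul, ← pow_mul, mul_comm (k i : ℕ)]
      ring
    rw [Finset.sum_congr rfl h1, Finset.sum_eq_single α]
    · simp
    · intro β _ hne
      obtain ⟨i, hi⟩ := Finsupp.ne_iff.mp hne
      rw [Finset.prod_eq_zero (Finset.mem_univ i) (if_neg hi), zero_mul]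
    · exact fun h => absurd hα h
  have hK0 : (0 : ℝ) < (K : ℝ) ^ n := pow_pos (by positivity) n
  have h2 : (K : ℝ) ^ n * (‖P.coeff α‖ * ∏ i, ‖z i‖ ^ α i) ≤ (K : ℝ) ^ n * B := by
    calc (K : ℝ) ^ n * (‖P.coeff α‖ * ∏ i, ‖z i‖ ^ α i)
        = ‖(K : ℂ) ^ n * (P.coeff α * ∏ i, z i ^ α i)‖ := by
          simp [norm_prod]
      _ ≤ ∑ k : Fin n → Fin K, ‖(∏ i, ((ω ^ α i)⁻¹) ^ (k i : ℕ)) *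
          MvPolynomial.eval (fun i => ω ^ (k i : ℕ) * z i) P‖ := by
          rw [← key]
          exact norm_sum_le _ _
      _ ≤ ∑ k : Fin n → Fin K, B := by
          refine Finset.sum_le_sum fun k _ => ?_
          rw [norm_mul, norm_prod]
          simp only [norm_pow, norm_inv, hω1, one_pow, inv_one, Finset.prod_const_one, one_mul]
          exact hB _ fun i => by simp [hω1]
      _ = (K : ℝ) ^ n * B := by simp
  exact le_of_mul_le_mul_left h2 hK0

/-- A monomial that is bounded on the open quarter of the unit circle has no pole on the
axis `x = 0`. -/
theorem nonneg_of_bounded_on_circle {a e : ℤ} {C : ℝ}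
    (h : ∀ x y : ℝ, 0 < x → 0 < y → x ^ 2 + y ^ 2 = 1 → x ^ a * y ^ e ≤ C) : 0 ≤ a := by
  by_contra! ha
  set c : ℝ := (1 / 2) ^ e.natAbs with hc
  have hc0 : 0 < c := by positivity
  have hc1 : c ≤ 1 := pow_le_one₀ (by norm_num) (by norm_num)
  set x : ℝ := c / (2 * (|C| + 1)) with hx
  have hx0 : 0 < x := by positivity
  have hx1 : x ≤ 1 / 2 := by
    rw [hx, div_le_div_iff₀ (by positivity) (by norm_num)]
    nlinarith [abs_nonneg C]
  set y : ℝ := √(1 - x ^ 2) with hy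
  have hyx : y ^ 2 = 1 - x ^ 2 := Real.sq_sqrt (by nlinarith)
  have hy0 : 1 / 2 ≤ y := Real.le_sqrt_of_sq_le (by nlinarith)
  have hy1 : y ≤ 1 := Real.sqrt_le_one.mpr (by nlinarith)
  have h1 : c ≤ y ^ e := by
    rcases le_total 0 e with he | he
    · obtain ⟨k, rfl⟩ := Int.eq_ofNat_of_zero_le he
      rw [hc, zpow_natCast, Int.natAbs_natCast]
      gcongr
    · exact hc1.trans (one_le_zpow_of_nonpos₀ (by linarith) hy1 he)
  have h2 : x⁻¹ ≤ x ^ a := by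
    rw [← zpow_neg_one]
    exact zpow_le_zpow_right_of_le_one₀ hx0 (by linarith) (by omega)
  have h3 := h x y hx0 (by linarith) (by linarith)
  have h4 : x⁻¹ * c ≤ x ^ a * y ^ e := mul_le_mul h2 h1 hc0.le (by positivity)
  have h5 : x⁻¹ * c = 2 * (|C| + 1) := by
    rw [hx]
    field_simp
  linarith [le_abs_self C, abs_nonneg C]

/-- A monomial in the `xᵢ, yᵢ` that is bounded on the product of the open quarters of the unit
circles has nonnegative exponents. -/
theorem nonneg_of_bounded_on_circles {n : ℕ} {a e : Fin n → ℤ} {C : ℝ}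
    (h : ∀ x y : Fin n → ℝ, (∀ i, 0 < x i) → (∀ i, 0 < y i) → (∀ i, x i ^ 2 + y i ^ 2 = 1) →
      ∏ i, x i ^ a i * y i ^ e i ≤ C) (k : Fin n) : 0 ≤ a k ∧ 0 ≤ e k := by
  have hs : (0 : ℝ) < √(1 / 2) := Real.sqrt_pos.mpr (by norm_num)
  have hs2 : √(1 / 2 : ℝ) ^ 2 = 1 / 2 := Real.sq_sqrt (by norm_num)
  set c : ℝ := ∏ i ∈ Finset.univ.erase k, √(1 / 2) ^ a i * √(1 / 2) ^ e i with hc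
  have hc0 : 0 < c := Finset.prod_pos fun i _ => by positivity
  have key : ∀ x y : ℝ, 0 < x → 0 < y → x ^ 2 + y ^ 2 = 1 → x ^ a k * y ^ e k ≤ C / c := by
    intro x y hx hy hxy
    have h1 := h (Function.update (fun _ => √(1 / 2)) k x) (Function.update (fun _ => √(1 / 2)) k y)
      (fun i => by by_cases hi : i = k <;> simp [hi, hx])
      (fun i => by by_cases hi : i = k <;> simp [hi, hy])
      (fun i => by
        by_cases hi : i = k
        · simp [hi, hxy]
        · simp only [Function.update_of_ne hi, hs2]
          norm_num)
    rw [← Finset.mul_prod_erase _ _ (Finset.mem_univ k)] at h1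
    have h2 : ∏ i ∈ Finset.univ.erase k, Function.update (fun _ => √(1 / 2)) k x i ^ a i *
        Function.update (fun _ => √(1 / 2)) k y i ^ e i = c := by
      refine Finset.prod_congr rfl fun i hi => ?_
      simp only [Function.update_of_ne (Finset.ne_of_mem_erase hi)]
    rw [h2, Function.update_self, Function.update_self] at h1
    rwa [le_div_iff₀ hc0]
  exact ⟨nonneg_of_bounded_on_circle key, nonneg_of_bounded_on_circle fun x y hx hy hxy =>
    (mul_comm _ _).trans_le (key y x hy hx ((add_comm _ _).trans hxy))⟩

namespace Data

variable {m : ℕ} {D : Data m}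

/-! ### The weight set -/

theorem unitary_mem_generic {v : Fin (m + 1) → UnitColumn}
    (hv : ∀ i, (v i).1.1 ≠ 0 ∧ (v i).1.2 ≠ 0) : D.unitary v ∈ D.generic := hv

theorem norm_monomialSection_unitary (lam : D.Weight) (η : Fin (m + 1) → ℤ)
    {v : Fin (m + 1) → UnitColumn} (hv : ∀ i, (v i).1.1 ≠ 0 ∧ (v i).1.2 ≠ 0) :
    ‖D.monomialSection lam η (D.unitary v)‖
      = ∏ i, ‖(v i).1.1‖ ^ η i * ‖(v i).1.2‖ ^ (D.height lam η i - η i) := by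
  rw [monomialSection_eq lam η (unitary_mem_generic hv), norm_mul, norm_sign, one_mul, norm_prod]
  refine Finset.prod_congr rfl fun i _ => ?_
  rw [norm_mul, norm_mul, norm_zpow, norm_zpow, mat_unitary_zero, mat_unitary_one,
    central_unitary]
  simp

/-- If `f_η` is bounded with respect to the unitary metric, then `η` belongs to the twisted
cube. -/
theorem mem_cube_of_bound {lam : D.Weight} {η : Fin (m + 1) → ℤ} {C : ℝ}
    (h : ∀ v : Fin (m + 1) → UnitColumn, (∀ i, (v i).1.1 ≠ 0 ∧ (v i).1.2 ≠ 0) →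
      ‖D.monomialSection lam η (D.unitary v)‖ ≤ C) (i : Fin (m + 1)) :
    0 ≤ η i ∧ η i ≤ D.height lam η i := by
  have key := nonneg_of_bounded_on_circles (a := η) (e := fun i => D.height lam η i - η i)
    (C := C) (fun x y hx hy hxy => ?_) i
  · exact ⟨key.1, sub_nonneg.mp key.2⟩
  · have hx' : ∀ i, ‖(x i : ℂ)‖ = x i := fun i => by
      rw [Complex.norm_real, Real.norm_of_nonneg (hx i).le]
    have hy' : ∀ i, ‖(y i : ℂ)‖ = y i := fun i => by
      rw [Complex.norm_real, Real.norm_of_nonneg (hy i).le]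
    have hv : ∀ i, ‖(x i : ℂ)‖ ^ 2 + ‖(y i : ℂ)‖ ^ 2 = 1 := fun i => by rw [hx', hy', hxy i]
    have hne : ∀ i, (x i : ℂ) ≠ 0 ∧ (y i : ℂ) ≠ 0 := fun i =>
      ⟨by exact_mod_cast (hx i).ne', by exact_mod_cast (hy i).ne'⟩
    have h1 := h (fun i => ⟨((x i : ℂ), (y i : ℂ)), hv i⟩) hne
    rw [norm_monomialSection_unitary lam η hne] at h1
    simpa only [hx', hy'] using h1

theorem mem_weightSet_iff (lam : D.Weight) (η : Fin (m + 1) → ℤ) :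
    η ∈ D.weightSet lam ↔ ∀ i, 0 ≤ η i ∧ η i ≤ D.height lam η i := by
  constructor
  · rintro ⟨F, hF, hext⟩
    obtain ⟨C, hC⟩ := D.exists_bound_unitary hF.1.continuous
    refine mem_cube_of_bound (C := C) fun v hv => ?_
    rw [← hext _ (proj_mem_openOrbit.mpr (unitary_mem_generic hv))]
    exact hC v
  · exact fun h => ⟨_, cubeSection_mem h, isExtension_cubeSection h⟩

/-! ### Sections in the affine coordinates -/

/-- A section is determined by its restriction to the open orbit. -/
theorem section_ext {lam : D.Weight} {f f' : D.Gs → ℂ} (hf : f ∈ D.sections lam)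
    (hf' : f' ∈ D.sections lam) (h : ∀ z, (∀ i, z i ≠ 0) → f (D.rep z) = f' (D.rep z)) :
    f = f' := by
  refine Continuous.ext_on D.dense_generic hf.1.continuous hf'.1.continuous fun g hg => ?_
  have hr := related_rep (generic_subset_bigCell hg)
  have hz : ∀ i, D.affineCoord g i ≠ 0 := fun i =>
    mul_ne_zero (div_ne_zero (hg i).1 (hg i).2) (Units.ne_zero _)
  have h1 := h _ hz
  rw [hr.apply_section hf, hr.apply_section hf'] at h1
  exact mul_right_cancel₀ (Units.ne_zero _) h1

theorem cubeSection_rep {lam : D.Weight} {η : Fin (m + 1) → ℤ}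
    (hη : ∀ i, 0 ≤ η i ∧ η i ≤ D.height lam η i) {z : Fin (m + 1) → ℂ} (hz : ∀ i, z i ≠ 0) :
    D.cubeSection lam η (D.rep z) = D.sign lam * ∏ i, z i ^ η i := by
  have hg : D.rep z ∈ D.generic := fun i => by simp [mat_rep, hz i]
  rw [cubeSection_eq hη hg, monomialSection, coord_proj (rep_mem_bigCell z), affineCoord_rep,
    cSection_eq lam (rep_mem_bigCell z), lowerTorus_rep]
  simp [mul_comm]

theorem one_le_radius_rep (z : Fin (m + 1) → ℂ) (i : Fin (m + 1)) :
    1 ≤ D.radius (D.rep z) i := by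
  have h := radius_rep_sq (D := D) z i
  have h0 := D.radius_pos (D.rep z) i
  have h1 : 0 ≤ ‖z i‖ ^ 2 * ∏ k, (D.radius (D.rep z) k ^ 2) ^ D.rootWeight i k 0 :=
    mul_nonneg (by positivity) (Finset.prod_nonneg fun k _ => by positivity)
  nlinarith

theorem zpow_le_pow_of_bound {r B : ℝ} {N : ℕ} (h1 : 1 ≤ r) (h2 : r ≤ B ^ N) (M : ℤ) :
    r ^ M ≤ B ^ (N * M.natAbs) := by
  calc r ^ M ≤ r ^ (M.natAbs : ℤ) := zpow_le_zpow_right₀ h1 Int.le_natAbs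
    _ = r ^ M.natAbs := zpow_natCast _ _
    _ ≤ (B ^ N) ^ M.natAbs := by gcongr
    _ = B ^ (N * M.natAbs) := (pow_mul _ _ _).symm

/-- The radii, hence the unitary metric, grow at most polynomially in the affine coordinates. -/
theorem exists_radius_growth (i : Fin (m + 1)) :
    ∃ N : ℕ, ∀ z, D.radius (D.rep z) i ≤ (1 + ‖z‖) ^ N := by
  induction i using WellFoundedGT.induction with
  | ind i ih =>
    have h1 : ∀ k, ∃ N : ℕ, ∀ z : Fin (m + 1) → ℂ,
        (D.radius (D.rep z) k ^ 2) ^ D.rootWeight i k 0 ≤ (1 + ‖z‖) ^ N := by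
      intro k
      by_cases hk : i < k
      · obtain ⟨N, hN⟩ := ih k hk
        refine ⟨N * 2 * (D.rootWeight i k 0).natAbs, fun z => ?_⟩
        refine zpow_le_pow_of_bound (one_le_pow₀ (one_le_radius_rep z k)) ?_ _
        rw [pow_mul]
        exact pow_le_pow_left₀ (D.radius_pos _ k).le (hN z) 2
      · exact ⟨0, fun z => by simp [D.rootWeight_eq_zero (not_lt.mp hk)]⟩
    choose N hN using h1
    refine ⟨2 + ∑ k, N k, fun z => ?_⟩
    have hP : ∏ k, (D.radius (D.rep z) k ^ 2) ^ D.rootWeight i k 0 ≤ (1 + ‖z‖) ^ ∑ k, N k := by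
      rw [← Finset.prod_pow_eq_pow_sum]
      exact Finset.prod_le_prod (fun k _ => by positivity) fun k _ => hN k z
    have hB : 1 ≤ (1 + ‖z‖) ^ ∑ k, N k := one_le_pow₀ (by linarith [norm_nonneg z])
    have hz : ‖z i‖ ^ 2 ≤ ‖z‖ ^ 2 := by gcongr; exact norm_le_pi_norm z i
    have h2 : D.radius (D.rep z) i ^ 2 ≤ ‖z‖ ^ 2 * (1 + ‖z‖) ^ ∑ k, N k + 1 := by
      rw [radius_rep_sq]
      gcongr
    have h3 : D.radius (D.rep z) i ≤ D.radius (D.rep z) i ^ 2 :=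
      le_self_pow₀ (one_le_radius_rep z i) two_ne_zero
    rw [pow_add]
    nlinarith [norm_nonneg z]

theorem exists_section_growth {lam : D.Weight} {f : D.Gs → ℂ} (hf : f ∈ D.sections lam) :
    ∃ (C : ℝ) (N : ℕ), 0 ≤ C ∧ ∀ z, ‖f (D.rep z)‖ ≤ C * (1 + ‖z‖) ^ N := by
  obtain ⟨C, hC⟩ := D.exists_bound_unitary hf.1.continuous
  choose N hN using fun i => exists_radius_growth (D := D) i
  refine ⟨|C|, ∑ i, N i * (lam i 0).natAbs, abs_nonneg C, fun z => ?_⟩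
  obtain ⟨v, hv⟩ := exists_related_unitary (D.rep z)
  have h1 : f (D.rep z) = f (D.unitary v) *
      ((D.weightChar lam (D.polarTorus (D.rep z)) : ℂˣ) : ℂ) := by
    rw [hv.apply_section hf, map_inv, mul_assoc, Units.inv_mul, mul_one]
  rw [h1, norm_mul, norm_weightChar_polarTorus_rep]
  refine mul_le_mul ((hC v).trans (le_abs_self C)) ?_ ?_ (abs_nonneg C)
  · rw [← Finset.prod_pow_eq_pow_sum]
    exact Finset.prod_le_prod (fun i _ => (zpow_pos (D.radius_pos _ i) _).le) fun i _ =>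
      zpow_le_pow_of_bound (one_le_radius_rep z i) (hN i z) _
  · exact Finset.prod_nonneg fun i _ => (zpow_pos (D.radius_pos _ i) _).le

/-- Sections are polynomials in the affine coordinates. -/
theorem exists_mvPolynomial {lam : D.Weight} {f : D.Gs → ℂ} (hf : f ∈ D.sections lam) :
    ∃ P : MvPolynomial (Fin (m + 1)) ℂ, ∀ z, f (D.rep z) = MvPolynomial.eval z P := by
  obtain ⟨C, N, hC0, hC⟩ := exists_section_growth hf
  refine exists_mvPolynomial_of_separately (N := N + 1) (fun z => f (D.rep z)) fun z i => ?_
  have hupd : Differentiable ℂ (fun t : ℂ => Function.update z i t) := by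
    rw [differentiable_pi]
    intro j
    by_cases hj : j = i
    · subst hj; simp
    · simp [Function.update_of_ne hj]
  have hF : Differentiable ℂ (fun z => f (D.rep z)) := fun x =>
    (hf.1.analyticAt_comp D.continuous_rep (D.analyticAt_toAmbient_rep x)).differentiableAt
  refine exists_polynomial_of_growth (C := C * (1 + ‖z‖) ^ N) (hF.comp hupd) fun t => ?_
  have h1 : ‖Function.update z i t‖ ≤ ‖z‖ + ‖t‖ := by
    rw [pi_norm_le_iff_of_nonneg (by positivity)]
    intro j
    by_cases hj : j = i
    · subst hj
      simp
    · rw [Function.update_of_ne hj]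
      exact (norm_le_pi_norm z j).trans (le_add_of_nonneg_right (norm_nonneg t))
  refine (hC _).trans ?_
  rw [mul_assoc, ← mul_pow]
  gcongr
  nlinarith [norm_nonneg z, norm_nonneg t]

/-- The exponents of the monomials occurring in a section belong to the weight set: by averaging
over the compact torus, each of these monomials is bounded in the unitary metric. -/
theorem mem_weightSet_of_coeff_ne_zero {lam : D.Weight} {f : D.Gs → ℂ} (hf : f ∈ D.sections lam)
    {P : MvPolynomial (Fin (m + 1)) ℂ} (hP : ∀ z, f (D.rep z) = MvPolynomial.eval z P)
    {α : Fin (m + 1) →₀ ℕ} (hα : P.coeff α ≠ 0) :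
    (fun i => (α i : ℤ)) ∈ D.weightSet lam := by
  rw [mem_weightSet_iff]
  obtain ⟨C, hC⟩ := D.exists_bound_unitary hf.1.continuous
  refine mem_cube_of_bound (C := C / ‖P.coeff α‖) fun v hv => ?_
  have hu : D.unitary v ∈ D.bigCell := fun i => (hv i).2
  set T : ℝ := ‖((D.weightChar lam (D.lowerTorus (D.unitary v)) : ℂˣ) : ℂ)‖ with hT
  have hT0 : 0 < T := norm_pos_iff.mpr (Units.ne_zero _)
  have hbd : ∀ ζ : Fin (m + 1) → ℂ, (∀ i, ‖ζ i‖ = 1) →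
      ‖MvPolynomial.eval (fun i => ζ i * D.affineCoord (D.unitary v) i) P‖ ≤ C / T := by
    intro ζ hζ
    let v' : Fin (m + 1) → UnitColumn := fun i => ⟨(ζ i * (v i).1.1, (v i).1.2), by
      rw [norm_mul, hζ, one_mul]
      exact (v i).2⟩
    have hu' : D.unitary v' ∈ D.bigCell := fun i => (hv i).2
    have hl : D.lowerTorus (D.unitary v') = D.lowerTorus (D.unitary v) :=
      torus_ext (fun i => by rw [lowerTorus_zero hu, lowerTorus_zero hu']; rfl)
        (fun i => by rw [tail_lowerTorus, tail_lowerTorus]; rfl)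
    have hz : D.affineCoord (D.unitary v') = fun i => ζ i * D.affineCoord (D.unitary v) i := by
      funext i
      rw [affineCoord, affineCoord, hl, mat_unitary_zero, mat_unitary_one, mat_unitary_zero,
        mat_unitary_one]
      ring
    rw [← hz, ← hP, (related_rep hu').apply_section hf, norm_mul, hl, map_inv,
      Units.val_inv_eq_inv_val, norm_inv, ← div_eq_mul_inv]
    exact div_le_div_of_nonneg_right (hC v') hT0.le
  have h1 := norm_coeff_mul_le P _ hbd α
  have h2 : ‖D.monomialSection lam (fun i => (α i : ℤ)) (D.unitary v)‖
      = (∏ i, ‖D.affineCoord (D.unitary v) i‖ ^ α i) * T := by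
    rw [monomialSection, coord_proj hu, cSection_eq lam hu, norm_mul, norm_mul, norm_sign,
      one_mul, norm_prod]
    simp [hT]
  rw [h2, le_div_iff₀ (norm_pos_iff.mpr hα)]
  rw [le_div_iff₀ hT0] at h1
  linarith

/-! ### The basis of monomial sections -/

/-- The extension of `f_η` for `η` in the weight set. -/
def weightSection (lam : D.Weight) (η : D.weightSet lam) : D.sections lam :=
  ⟨D.cubeSection lam η.1, cubeSection_mem ((mem_weightSet_iff lam _).mp η.2)⟩

theorem weightSection_rep (lam : D.Weight) (η : D.weightSet lam) {z : Fin (m + 1) → ℂ}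
    (hz : ∀ i, z i ≠ 0) :
    (weightSection lam η : D.Gs → ℂ) (D.rep z) = D.sign lam * ∏ i, z i ^ η.1 i :=
  cubeSection_rep ((mem_weightSet_iff lam _).mp η.2) hz

theorem character_injective {n : ℕ} :
    Function.Injective (character : (Fin n → ℤ) → ((Fin n → ℂˣ) →* ℂˣ)) := by
  intro v w h
  funext i
  have h1 := DFunLike.congr_fun h (Pi.mulSingle i (Units.mk0 (2 : ℂ) two_ne_zero))
  have h2 : ∀ u : Fin n → ℤ, ((character u (Pi.mulSingle i (Units.mk0 (2 : ℂ) two_ne_zero)) : ℂˣ) :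
      ℂ) = 2 ^ u i := by
    intro u
    change ((∏ a, (Pi.mulSingle i (Units.mk0 (2 : ℂ) two_ne_zero) : Fin n → ℂˣ) a ^ u a : ℂˣ) :
      ℂ) = _
    rw [Finset.prod_eq_single i]
    · simp
    · intro b _ hb
      simp [hb]
    · simp
  have h3 := congrArg (fun x : ℂˣ => ‖(x : ℂ)‖) h1
  simp only [h2, norm_zpow, Complex.norm_ofNat] at h3
  exact zpow_right_injective₀ (by norm_num) (by norm_num) h3

/-- Distinct characters of the torus are linearly independent. -/
theorem linearIndependent_weightSection (lam : D.Weight) :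
    LinearIndependent ℂ (weightSection (D := D) lam) := by
  let φ : D.weightSet lam → ((Fin (m + 1) → ℂˣ) →* ℂ) := fun η =>
    (Units.coeHom ℂ).comp (character η.1)
  have hφ : Function.Injective φ := by
    intro η η' h
    refine Subtype.ext (character_injective (MonoidHom.ext fun t => Units.ext ?_))
    exact DFunLike.congr_fun h t
  have hli := (linearIndependent_monoidHom (Fin (m + 1) → ℂˣ) ℂ).comp φ hφ
  let R : D.sections lam →ₗ[ℂ] ((Fin (m + 1) → ℂˣ) → ℂ) :=
    { toFun := fun f t => (D.sign lam)⁻¹ * (f : D.Gs → ℂ) (D.rep fun i => (t i : ℂ))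
      map_add' := fun f g => by
        funext t
        simp [mul_add]
      map_smul' := fun c f => by
        funext t
        simp [mul_left_comm] }
  have hR : R ∘ weightSection lam = (fun f : (Fin (m + 1) → ℂˣ) →* ℂ => ⇑f) ∘ φ := by
    funext η t
    change (D.sign lam)⁻¹ * (weightSection lam η : D.Gs → ℂ) (D.rep fun i => (t i : ℂ))
      = ((character η.1 t : ℂˣ) : ℂ)
    rw [weightSection_rep lam η fun i => Units.ne_zero _,
      inv_mul_cancel_left₀ (sign_ne_zero lam)]
    simp [character]
  refine LinearIndependent.of_comp R ?_
  rw [hR]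
  exact hli

theorem span_weightSection (lam : D.Weight) :
    ⊤ ≤ Submodule.span ℂ (Set.range (weightSection (D := D) lam)) := by
  rintro ⟨f, hf⟩ -
  obtain ⟨P, hP⟩ := exists_mvPolynomial hf
  let η : P.support → D.weightSet lam := fun α => ⟨fun i => (α.1 i : ℤ),
    mem_weightSet_of_coeff_ne_zero hf hP (MvPolynomial.mem_support_iff.mp α.2)⟩
  let F : D.sections lam :=
    ∑ α : P.support, ((D.sign lam)⁻¹ * P.coeff α.1) • weightSection lam (η α)
  have hF : (⟨f, hf⟩ : D.sections lam) = F := by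
    refine Subtype.ext (section_ext hf F.2 fun z hz => ?_)
    have h1 : (F : D.Gs → ℂ) (D.rep z) = ∑ α : P.support,
        ((D.sign lam)⁻¹ * P.coeff α.1) * (weightSection lam (η α) : D.Gs → ℂ) (D.rep z) := by
      simp [F]
    change f (D.rep z) = _
    rw [h1, hP, MvPolynomial.eval_eq', ← Finset.sum_coe_sort]
    refine Finset.sum_congr rfl fun α _ => ?_
    rw [weightSection_rep lam _ hz]
    have := sign_ne_zero (D := D) lam
    simp only [η, zpow_natCast]
    field_simp
  rw [hF]
  exact Submodule.sum_mem _ fun α _ => Submodule.smul_mem _ _ (Submodule.subset_span ⟨_, rfl⟩)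

end Data

end

end P1Chain

theorem theorem7p3 {m : ℕ} (D : P1Chain.Data m) (lam : D.Weight)
    (hpos : D.PositivityCondition lam) :
    (∀ η : Fin (m + 1) → ℤ,
      η ∈ D.weightSet lam ↔ (fun i => (η i : ℝ)) ∈ Set.range (D.momentMap lam)) ∧
    ∃ b : Module.Basis (D.weightSet lam) ℂ (D.sections lam),
      ∀ η : D.weightSet lam, D.IsExtension lam η.1 (b η : D.Gs → ℂ) := by
  refine ⟨fun η => ?_, Module.Basis.mk (P1Chain.Data.linearIndependent_weightSection lam)
    (P1Chain.Data.span_weightSection lam), fun η => ?_⟩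
  · rw [P1Chain.Data.mem_weightSet_iff, P1Chain.Data.range_momentMap hpos]
    refine forall_congr' fun i => ?_
    rw [P1Chain.Data.height_eq]
    refine and_congr (by simp) ?_
    rw [← Int.cast_le (R := ℝ)]
    push_cast
    rfl
  · rw [Module.Basis.mk_apply]
    exact P1Chain.Data.isExtension_cubeSection
      ((P1Chain.Data.mem_weightSet_iff lam _).mp η.2)
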